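/- Let $(M,F)$ be a Finsler manifold: $M$ is a finite-dimensional smooth manifold (Hausdorff, second countable, without boundary) and $F:TM\to[0,\infty)$ is $C^\infty$ on $TM\setminus 0$, positively homogeneous of degree one on each tangent space (not necessarily reversible), and strongly convex, i.e. $g_{ij}(x,y)=\tfrac12[F^2]_{y^iy^j}(x,y)$ is positive definite for $y\neq 0$. Geodesics are the curves that satisfy, in local coordinates, $$\frac{d^2\gamma^i}{dt^2}+2G^i\Big(\gamma,\frac{d\gamma}{dt}\Big)=0,\qquad G^i=\tfrac14 g^{il}\big\{[F^2]_{x^ky^l}y^k-[F^2]_{x^l}\big\}.$$ The distance $d(p,q)$ is the infimum of the lengths $\int_a^b F(c'(t))\,dt$ of piecewise smooth curves $c:[a,b]\to M$ from $p$ to $q$ (with $d(p,q)=\infty$ if there are none). A function $f:M\to\mathbf R$ is called locally Lipschitz if for each compact $K\subset M$ there is $L\ge 0$ such that $|f(p)-f(q)|\le L\,d(p,q)$ for all $p,q\in K$. It is called geodesically convex (in the strong sense) if for each compact $K\subset M$ there is $\lambda_K>0$ such that $$Cf(p,v):=\liminf_{r\to0}\frac1{r^2}\Big\{f(c(r))+f(c(-r))-2f(c(0))\Big\}\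 \ge\ \lambda_K$$ for all $p\in K$ and all $v\in T_pM$ with $F(v)=1$, where $c:(-\delta,\delta)\to M$ is a geodesic with $c(0)=p$ and $c'(0)=v$ (the value $+\infty$ is allowed for $Cf(p,v)$). Theorem. Let $f:M\to\mathbf R$ be locally Lipschitz and geodesically convex. Then for every $\varepsilon>0$ there is a $C^\infty$ geodesically convex function $g:M\to\mathbf R$ such that $|g-f|<\varepsilon$ on $M$. -/

import Mathlib

open Set Filter Topology MeasureTheory
open scoped Manifold ContDiff ENNReal NNReal

noncomputable section

namespace Finsler

/-- Second derivative `[N²]_{uw}(v)` along `u` and `w`, halved: for a Minkowski norm `N` on `V`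
this is the fundamental tensor `g_v(u, w)`, with `g_v(eᵢ, eⱼ) = gᵢⱼ(v) = ½ [N²]_{vⁱvʲ}(v)`. -/
def fundamentalTensor {V : Type*} [AddCommGroup V] [Module ℝ V] (N : V → ℝ) (v u w : V) : ℝ :=
  (1 / 2) * lineDeriv ℝ (fun v' => lineDeriv ℝ (fun v'' => N v'' ^ 2) v' w) v u

/-- A Finsler metric on the `n`-dimensional smooth manifold `M`: a nonnegative function on the
tangent bundle, `C^∞` off the zero section, whose restriction to every tangent space is positively
homogeneous of degree one and strongly convex. -/
structure FinslerMetric (n : ℕ) (M : Type*) [TopologicalSpace M]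
    [ChartedSpace (EuclideanSpace ℝ (Fin n)) M] [IsManifold (𝓡 n) ∞ M] where
  toFun : TangentBundle (𝓡 n) M → ℝ
  nonneg : ∀ v : TangentBundle (𝓡 n) M, 0 ≤ toFun v
  smooth : ContMDiffOn (𝓡 n).tangent 𝓘(ℝ, ℝ) ∞ toFun
    {v : TangentBundle (𝓡 n) M | v.snd ≠ 0}
  homogeneous : ∀ (x : M) (v : TangentSpace (𝓡 n) x) (t : ℝ), 0 ≤ t →
    toFun ⟨x, t • v⟩ = t * toFun ⟨x, v⟩
  strongly_convex : ∀ (x : M) (v u : TangentSpace (𝓡 n) x), v ≠ 0 → u ≠ 0 →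
    0 < fundamentalTensor (fun v' : TangentSpace (𝓡 n) x => toFun ⟨x, v'⟩) v u u

section

variable {n : ℕ} {M : Type*} [TopologicalSpace M] [ChartedSpace (EuclideanSpace ℝ (Fin n)) M]
  [IsManifold (𝓡 n) ∞ M]

/-- The velocity `γ'(t)`, as a point of the tangent bundle. -/
def velocity (γ : ℝ → M) (t : ℝ) : TangentBundle (𝓡 n) M :=
  ⟨γ t, mfderiv 𝓘(ℝ, ℝ) (𝓡 n) γ t (1 : ℝ)⟩

/-- `γ` is piecewise `C^∞` on `[a, b]`: there is a subdivision of `[a, b]` such that `γ` is `C^∞`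
on each of its closed subintervals (so that `γ` is continuous on `[a, b]`). -/
def PiecewiseSmoothOn (n : ℕ) {M : Type*} [TopologicalSpace M]
    [ChartedSpace (EuclideanSpace ℝ (Fin n)) M] (γ : ℝ → M) (a b : ℝ) : Prop :=
  ∃ (k : ℕ) (t : Fin (k + 1) → ℝ), Monotone t ∧ t 0 = a ∧ t (Fin.last k) = b ∧
    ∀ i : Fin k, ContMDiffOn 𝓘(ℝ, ℝ) (𝓡 n) ∞ γ (Icc (t i.castSucc) (t i.succ))

/-- The length of `γ` on `[a, b]`; the finitely many break points do not matter. -/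
def FinslerMetric.length (F : FinslerMetric n M) (γ : ℝ → M) (a b : ℝ) : ℝ≥0∞ :=
  ∫⁻ t in Icc a b, ENNReal.ofReal (F.toFun (velocity γ t))

/-- The (in general non-symmetric) Finsler distance from `p` to `q`: the infimum of the lengths of
piecewise smooth curves from `p` to `q` (infinite if there are none). -/
def FinslerMetric.dist (F : FinslerMetric n M) (p q : M) : ℝ≥0∞ :=
  ⨅ (γ : ℝ → M) (a : ℝ) (b : ℝ) (_ : a ≤ b) (_ : PiecewiseSmoothOn n γ a b) (_ : γ a = p)
    (_ : γ b = q), F.length γ a b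

/-- `f` is Lipschitz, with respect to the Finsler distance, on every compact subset of `M`. -/
def FinslerMetric.LocallyLipschitz (F : FinslerMetric n M) (f : M → ℝ) : Prop :=
  ∀ K : Set M, IsCompact K → ∃ L : ℝ≥0, ∀ p ∈ K, ∀ q ∈ K,
    ENNReal.ofReal |f p - f q| ≤ (L : ℝ≥0∞) * F.dist p q

/-- The function `(x, y) ↦ F(x, y)` in the local coordinates of a chart `φ`: its value at `x` and
`y = (y¹, …, yⁿ)` is the value of `F` at the vector `yⁱ ∂/∂xⁱ` at the point `φ⁻¹(x)`. -/
def FinslerMetric.inChart (F : FinslerMetric n M)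
    (φ : OpenPartialHomeomorph M (EuclideanSpace ℝ (Fin n))) (x y : EuclideanSpace ℝ (Fin n)) : ℝ :=
  F.toFun ⟨φ.symm x, mfderiv (𝓡 n) (𝓡 n) φ.symm x y⟩

/-- The matrix `gᵢⱼ(x, y) = ½ [F²]_{yⁱyʲ}(x, y)` in the local coordinates of `φ`. -/
def FinslerMetric.gMatrix (F : FinslerMetric n M)
    (φ : OpenPartialHomeomorph M (EuclideanSpace ℝ (Fin n))) (x y : EuclideanSpace ℝ (Fin n)) :
    Matrix (Fin n) (Fin n) ℝ :=
  Matrix.of fun i j => fundamentalTensor (F.inChart φ x) y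
    (EuclideanSpace.single i 1) (EuclideanSpace.single j 1)

/-- The geodesic spray coefficients in the local coordinates of `φ`:
`Gⁱ = ¼ gⁱˡ ([F²]_{xᵏyˡ} yᵏ - [F²]_{xˡ})`. -/
def FinslerMetric.spray (F : FinslerMetric n M)
    (φ : OpenPartialHomeomorph M (EuclideanSpace ℝ (Fin n))) (x y : EuclideanSpace ℝ (Fin n))
    (i : Fin n) : ℝ :=
  (1 / 4) * ∑ l : Fin n, (F.gMatrix φ x y)⁻¹ i l *
    ((∑ k : Fin n,
        lineDeriv ℝ (fun x' => lineDeriv ℝ (fun y' => F.inChart φ x' y' ^ 2) y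
          (EuclideanSpace.single l 1)) x (EuclideanSpace.single k 1) * y k)
      - lineDeriv ℝ (fun x' => F.inChart φ x' y ^ 2) x (EuclideanSpace.single l 1))

/-- `γ` is a geodesic on the open set `J ⊆ ℝ` (an open interval in the use below): it is `C²` there
and satisfies `d²γⁱ/dt² + 2 Gⁱ(γ, dγ/dt) = 0` in all local coordinates. -/
def FinslerMetric.IsGeodesicOn (F : FinslerMetric n M) (γ : ℝ → M) (J : Set ℝ) : Prop :=
  ContMDiffOn 𝓘(ℝ, ℝ) (𝓡 n) 2 γ J ∧
    ∀ φ ∈ IsManifold.maximalAtlas (𝓡 n) ∞ M, ∀ t ∈ J, γ t ∈ φ.source → ∀ i : Fin n,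
      deriv (deriv fun s => φ (γ s) i) t + 2 * F.spray φ (φ (γ t)) (deriv (φ ∘ γ) t) i = 0

/-- `Cf(p, v) = liminf_{r → 0} r⁻² (f(c(r)) + f(c(-r)) - 2 f(c(0)))`, where `c` is the geodesic with
`c(0) = p` and `c'(0) = v`; the value may be infinite. -/
def lowerSecondDeriv {M : Type*} (f : M → ℝ) (c : ℝ → M) : EReal :=
  liminf (fun r : ℝ => (((f (c r) + f (c (-r)) - 2 * f (c 0)) / r ^ 2 : ℝ) : EReal)) (𝓝[≠] 0)

/-- Geodesic convexity: for every compact `K` there is `lam > 0` such that `Cf(p, v) ≥ lam` for all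
`p ∈ K` and all `F`-unit vectors `v` at `p`. -/
def FinslerMetric.GeodesicallyConvex (F : FinslerMetric n M) (f : M → ℝ) : Prop :=
  ∀ K : Set M, IsCompact K → ∃ lam : ℝ, 0 < lam ∧ ∀ (c : ℝ → M) (δ : ℝ), 0 < δ →
    F.IsGeodesicOn c (Ioo (-δ) δ) → c 0 ∈ K → F.toFun (velocity c 0) = 1 →
      (lam : EReal) ≤ lowerSecondDeriv f c

end

end Finsler

end

/-!
Smooth approximation of geodesically convex functions on a Finsler manifold.

In a chart, geodesics are the solutions of `ξ'' = -2 G(ξ, ξ')`. Let `h` be the coordinate expression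
of the given function, and `h_σ` its convolution with a bump function of radius `σ`. If `ξ` is a
geodesic through `x` and `α_z` the geodesic through `x - z` with the same initial velocity, then
`‖ξ(r) - z - α_z(r)‖ ≤ C (‖z‖ + |r|) r²`, since the accelerations at `x` and `x - z` are close
(`norm_sub_sub_le_of_isSolutionIn`). As `h` is Lipschitz, the second differences of `h_σ` along `ξ`
are averages of second differences of `h` along the geodesics `α_z`, up to an error `O(σ + |r|) r²`
(`exists_mollify_secondDiff`). The latter are at least `μ r²` on a fixed interval, not only in the
limit `r → 0`: a function of one variable whose lower second derivative is positive everywhere is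
convex, by the maximum principle (`le_secondDiff_of_eventually`). So `h_σ` is geodesically convex
for small `σ`, uniformly on compact sets (`exists_local_smoothing`).

This argument needs honest geodesics of `M` through all points near `x`, and the definition asks for
the geodesic equation in every chart. The equation is equivalent to the vanishing of the
Euler–Lagrange expression of `F²` (`eulerLagrange_accel`, `eq_of_eulerLagrange_eq`), which is a
covector (`eulerLagrange_comp`); hence a solution in one chart is a solution in all of them
(`accel_trans`, `IsSolutionIn.isGeodesicOn`). Since the hypothesis concerns unit speed geodesics
only, the homogeneity of the spray is used to reparametrize.

To pass to all of `M`, smooth the function successively on the members of a countable, locally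
finite cover by supports of bump functions (`exists_smoothing_step`). On the support of `b`, the
function `f` is replaced by a smooth maximum of `f` and `u = h_σ + δ (b - 1/2)`. Where `b = 1`, `u`
dominates and the result is smooth; where `b = 0`, `f` dominates and nothing changes. The smooth
maximum of two geodesically convex functions is geodesically convex (`softMax_secondDiff`), and it
is smooth where both are. The resulting sequence is locally eventually constant and its limit is
the required function.
-/

namespace Finsler

/-! ### Second differences of functions of one real variable -/

/-- The lower second derivative in terms of inequalities without quotients; at `r = 0` both sides
of the inequality vanish, so that full neighbourhoods of `0` can be used. -/
theorem le_lowerSecondDeriv_iff {M : Type*} {f : M → ℝ} {c : ℝ → M} {lam : ℝ} :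
    (lam : EReal) ≤ lowerSecondDeriv f c ↔
      ∀ μ < lam, ∀ᶠ r in 𝓝 (0 : ℝ), μ * r ^ 2 ≤ f (c r) + f (c (-r)) - 2 * f (c 0) := by
  have key : ∀ μ : ℝ, (∀ᶠ r in 𝓝 (0 : ℝ), μ * r ^ 2 ≤ f (c r) + f (c (-r)) - 2 * f (c 0)) ↔
      ∀ᶠ r in 𝓝[≠] (0 : ℝ), μ ≤ (f (c r) + f (c (-r)) - 2 * f (c 0)) / r ^ 2 := by
    intro μ
    rw [eventually_nhdsWithin_iff]
    refine eventually_congr (Eventually.of_forall fun r => ?_)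
    by_cases hr : r = 0
    · subst hr
      simp only [mem_compl_iff, mem_singleton_iff, not_true_eq_false, IsEmpty.forall_iff,
        iff_true, neg_zero]
      nlinarith
    · have : (0 : ℝ) < r ^ 2 := by positivity
      simp [hr, le_div_iff₀ this]
  constructor
  · intro h μ hμ
    rw [key]
    have h1 : (μ : EReal) < lowerSecondDeriv f c :=
      lt_of_lt_of_le (EReal.coe_lt_coe_iff.2 hμ) h
    filter_upwards [eventually_lt_of_lt_liminf h1] with r hr
    exact (EReal.coe_lt_coe_iff.1 hr).le
  · intro h
    refine le_of_forall_lt fun b hb => ?_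
    obtain ⟨μ, hbμ, hμ⟩ := EReal.lt_iff_exists_real_btwn.1 hb
    refine lt_of_lt_of_le hbμ ?_
    refine le_liminf_of_le (by isBoundedDefault) ?_
    filter_upwards [(key μ).1 (h μ (EReal.coe_lt_coe_iff.1 hμ))] with r hr
    exact EReal.coe_le_coe_iff.2 hr

/-- A continuous function of one variable whose lower symmetric second derivative is everywhere
positive is midpoint convex: after subtraction of the chord, an interior maximum is impossible. -/
theorem two_mul_le_of_eventually_pos {k : ℝ → ℝ} {r : ℝ} (hr : 0 < r)
    (hk : ContinuousOn k (Icc (-r) r))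
    (h : ∀ t ∈ Ioo (-r) r, ∃ᶠ s in 𝓝 (0 : ℝ), 0 < k (t + s) + k (t - s) - 2 * k t) :
    2 * k 0 ≤ k r + k (-r) := by
  set ℓ : ℝ → ℝ := fun t => (k r + k (-r)) / 2 + (k r - k (-r)) / (2 * r) * t with hℓ
  have hcont : ContinuousOn (fun t => k t - ℓ t) (Icc (-r) r) := by
    refine hk.sub (Continuous.continuousOn ?_)
    fun_prop
  obtain ⟨t, ht, hmax⟩ := isCompact_Icc.exists_isMaxOn ⟨0, by constructor <;> linarith⟩ hcont
  have h0 : k 0 - ℓ 0 ≤ k t - ℓ t := hmax (by constructor <;> linarith)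
  have hr1 : ℓ r = k r := by simp only [hℓ]; field_simp; ring
  have hr2 : ℓ (-r) = k (-r) := by simp only [hℓ]; field_simp; ring
  have hend : t = r ∨ t = -r := by
    by_contra! hne
    have hto : t ∈ Ioo (-r) r := ⟨lt_of_le_of_ne ht.1 (Ne.symm hne.2), lt_of_le_of_ne ht.2 hne.1⟩
    have hev : ∀ᶠ s in 𝓝 (0 : ℝ), t + s ∈ Ioo (-r) r ∧ t - s ∈ Ioo (-r) r := by
      have h1 : ContinuousAt (fun s : ℝ => t + s) 0 := by fun_prop
      have h2 : ContinuousAt (fun s : ℝ => t - s) 0 := by fun_prop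
      exact (h1.eventually_mem (by simpa using Ioo_mem_nhds hto.1 hto.2)).and
        (h2.eventually_mem (by simpa using Ioo_mem_nhds hto.1 hto.2))
    obtain ⟨s, hs, hs1, hs2⟩ := ((h t hto).and_eventually hev).exists
    have e1 : k (t + s) - ℓ (t + s) ≤ k t - ℓ t := hmax (Ioo_subset_Icc_self hs1)
    have e2 : k (t - s) - ℓ (t - s) ≤ k t - ℓ t := hmax (Ioo_subset_Icc_self hs2)
    have e3 : ℓ (t + s) + ℓ (t - s) = 2 * ℓ t := by simp only [hℓ]; ring
    linarith
  have hℓ0 : ℓ 0 = (k r + k (-r)) / 2 := by simp [hℓ]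
  rcases hend with rfl | rfl <;> linarith

/-- A pointwise infinitesimal lower bound on symmetric second differences integrates to a bound on
an interval. -/
theorem le_secondDiff_of_eventually {k : ℝ → ℝ} {μ τ : ℝ} (hk : ContinuousOn k (Ioo (-τ) τ))
    (h : ∀ t ∈ Ioo (-τ) τ, ∀ μ' < μ, ∀ᶠ s in 𝓝 (0 : ℝ),
      μ' * s ^ 2 ≤ k (t + s) + k (t - s) - 2 * k t) :
    ∀ r ∈ Ioo (-τ) τ, μ * r ^ 2 ≤ k r + k (-r) - 2 * k 0 := by
  have main : ∀ r ∈ Ioo 0 τ, μ * r ^ 2 ≤ k r + k (-r) - 2 * k 0 := by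
    intro r hr
    have hr0 : 0 < r ^ 2 := by have := hr.1; positivity
    have hlt : ∀ μ' < μ, μ' ≤ (k r + k (-r) - 2 * k 0) / r ^ 2 := by
      intro μ' hμ'
      have hsub : Icc (-r) r ⊆ Ioo (-τ) τ := fun t ht =>
        ⟨by linarith [ht.1, hr.2], by linarith [ht.2, hr.2]⟩
      have := two_mul_le_of_eventually_pos (k := fun t => k t - μ' / 2 * t ^ 2) hr.1
        ((hk.mono hsub).sub (Continuous.continuousOn (by fun_prop))) (by
          intro t ht
          obtain ⟨ν, hν1, hν2⟩ := exists_between hμ'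
          have hev := h t (hsub (Ioo_subset_Icc_self ht)) ν hν2
          have hev' : ∀ᶠ s in 𝓝[≠] (0 : ℝ),
              0 < k (t + s) - μ' / 2 * (t + s) ^ 2 + (k (t - s) - μ' / 2 * (t - s) ^ 2)
                - 2 * (k t - μ' / 2 * t ^ 2) := by
            filter_upwards [hev.filter_mono nhdsWithin_le_nhds, self_mem_nhdsWithin] with s hs hs0
            have : 0 < s ^ 2 := by have : s ≠ 0 := hs0; positivity
            nlinarith
          exact hev'.frequently.filter_mono nhdsWithin_le_nhds)
      rw [le_div_iff₀ hr0]
      have e : (-r) ^ 2 = r ^ 2 := by ring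
      simp only [e] at this
      linarith
    rw [← le_div_iff₀ hr0]
    exact le_of_forall_lt_imp_le_of_dense hlt
  intro r hr
  rcases lt_trichotomy r 0 with h0 | h0 | h0
  · have := main (-r) ⟨by linarith, by linarith [hr.1]⟩
    rw [neg_neg] at this
    linarith [neg_sq r]
  · subst h0; simp; linarith
  · exact main r ⟨h0, hr.2⟩

/-- A curve with vanishing `1`-jet at `0` is bounded by its second derivative. -/
theorem norm_le_mul_sq_of_hasDerivAt {E : Type*} [NormedAddCommGroup E] [NormedSpace ℝ E]
    {ζ ζ₁ ζ₂ : ℝ → E} {A r : ℝ} (h1 : ∀ t, |t| ≤ |r| → HasDerivAt ζ (ζ₁ t) t)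
    (h2 : ∀ t, |t| ≤ |r| → HasDerivAt ζ₁ (ζ₂ t) t) (hA : ∀ t, |t| ≤ |r| → ‖ζ₂ t‖ ≤ A)
    (h01 : ζ 0 = 0) (h02 : ζ₁ 0 = 0) : ‖ζ r‖ ≤ A * r ^ 2 := by
  have hA0 : 0 ≤ A := (norm_nonneg _).trans (hA 0 (by simp))
  have hconv : Convex ℝ (Icc (-|r|) |r|) := convex_Icc _ _
  have h0 : (0 : ℝ) ∈ Icc (-|r|) |r| := ⟨by simp, abs_nonneg r⟩
  have hz1 : ∀ t, |t| ≤ |r| → ‖ζ₁ t‖ ≤ A * |r| := by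
    intro t ht
    have := hconv.norm_image_sub_le_of_norm_hasDerivWithin_le (f := ζ₁) (f' := ζ₂) (C := A)
      (fun x hx => (h2 x (abs_le.2 hx)).hasDerivWithinAt) (fun x hx => hA x (abs_le.2 hx)) h0
      (abs_le.1 ht)
    rw [h02, sub_zero, sub_zero] at this
    refine this.trans ?_
    rw [Real.norm_eq_abs]
    gcongr
  have := hconv.norm_image_sub_le_of_norm_hasDerivWithin_le (f := ζ) (f' := ζ₁) (C := A * |r|)
      (fun x hx => (h1 x (abs_le.2 hx)).hasDerivWithinAt) (fun x hx => hz1 x (abs_le.2 hx)) h0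
      (abs_le.1 le_rfl : r ∈ Icc (-|r|) |r|)
  rw [h01, sub_zero, sub_zero, Real.norm_eq_abs, mul_assoc, abs_mul_abs_self] at this
  rwa [sq]

/-! ### A smooth convex corner -/

/-- A smooth convex substitute for `t ↦ max t 0`: the primitive of the smooth transition function
that vanishes for `t ≤ 0`. -/
noncomputable def softPos (t : ℝ) : ℝ := ∫ s in (0 : ℝ)..t, Real.smoothTransition s

theorem hasDerivAt_softPos (t : ℝ) : HasDerivAt softPos (Real.smoothTransition t) t :=
  intervalIntegral.integral_hasDerivAt_right
    (Real.smoothTransition.continuous.intervalIntegrable _ _)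
    (Real.smoothTransition.continuous.stronglyMeasurableAtFilter _ _)
    Real.smoothTransition.continuousAt

theorem deriv_softPos : deriv softPos = Real.smoothTransition :=
  funext fun t => (hasDerivAt_softPos t).deriv

theorem contDiff_softPos : ContDiff ℝ ∞ softPos := by
  rw [contDiff_infty_iff_deriv, deriv_softPos]
  exact ⟨fun t => (hasDerivAt_softPos t).differentiableAt, Real.smoothTransition.contDiff⟩

theorem softPos_of_nonpos {t : ℝ} (ht : t ≤ 0) : softPos t = 0 := by
  unfold softPos
  rw [intervalIntegral.integral_congr (g := fun _ => (0 : ℝ))]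
  · simp
  · intro s hs
    rw [uIcc_of_ge ht] at hs
    exact Real.smoothTransition.zero_of_nonpos hs.2

/-- Beyond `1` the function `softPos` has slope one. -/
theorem softPos_of_one_le {t : ℝ} (ht : 1 ≤ t) : softPos t = t + (softPos 1 - 1) := by
  have h1 : softPos t = softPos 1 + ∫ s in (1 : ℝ)..t, Real.smoothTransition s :=
    (intervalIntegral.integral_add_adjacent_intervals
      (Real.smoothTransition.continuous.intervalIntegrable _ _)
      (Real.smoothTransition.continuous.intervalIntegrable _ _)).symm
  rw [h1, intervalIntegral.integral_congr (g := fun _ => (1 : ℝ))]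
  · simp; ring
  · intro s hs
    rw [uIcc_of_le ht] at hs
    exact Real.smoothTransition.one_of_one_le hs.1

theorem softPos_mono : Monotone softPos :=
  monotone_of_deriv_nonneg (contDiff_softPos.differentiable (by simp)) fun t => by
    rw [deriv_softPos]; exact Real.smoothTransition.nonneg t

theorem softPos_nonneg (t : ℝ) : 0 ≤ softPos t := by
  rcases le_total t 0 with h | h
  · rw [softPos_of_nonpos h]
  · rw [← softPos_of_nonpos le_rfl]; exact softPos_mono h

theorem lipschitzWith_softPos : LipschitzWith 1 softPos :=
  lipschitzWith_of_nnnorm_deriv_le (contDiff_softPos.differentiable (by simp)) fun t => by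
    rw [deriv_softPos, ← NNReal.coe_le_coe, coe_nnnorm, Real.norm_eq_abs,
      abs_of_nonneg (Real.smoothTransition.nonneg t)]
    exact Real.smoothTransition.le_one t

theorem convexOn_softPos : ConvexOn ℝ univ softPos :=
  MonotoneOn.convexOn_of_deriv convex_univ contDiff_softPos.continuous.continuousOn
    (contDiff_softPos.differentiable (by simp)).differentiableOn (by
      rw [deriv_softPos]; exact Real.smoothTransition.monotone.monotoneOn _)

/-- The smooth maximum `b + η θ((a - b) / η)` of `a` and `b`, where `θ` is `softPos`. It equals `b`
if `a ≤ b`, and differs from `a` by a constant if `a ≥ b + η`. -/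
noncomputable def softMax (η a b : ℝ) : ℝ := b + η * softPos ((a - b) / η)

theorem softMax_of_le {η a b : ℝ} (hη : 0 < η) (h : a ≤ b) : softMax η a b = b := by
  rw [softMax, softPos_of_nonpos (div_nonpos_of_nonpos_of_nonneg (by linarith) hη.le)]
  simp

theorem softMax_of_add_le {η a b : ℝ} (hη : 0 < η) (h : b + η ≤ a) :
    softMax η a b = a + η * (softPos 1 - 1) := by
  rw [softMax, softPos_of_one_le ((one_le_div hη).2 (by linarith))]
  field_simp
  ring

theorem abs_softMax_sub_le {η a b d : ℝ} (hη : 0 < η) (hd : 0 ≤ d) (h : a - b ≤ d) :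
    |softMax η a b - b| ≤ d := by
  rw [softMax, add_sub_cancel_left, abs_of_nonneg (mul_nonneg hη.le (softPos_nonneg _))]
  have h1 : softPos ((a - b) / η) ≤ softPos (d / η) := softPos_mono (by gcongr)
  have h2 := lipschitzWith_softPos.dist_le_mul (d / η) 0
  rw [softPos_of_nonpos le_rfl, dist_zero_right, dist_zero_right, Real.norm_eq_abs,
    Real.norm_eq_abs, abs_of_nonneg (softPos_nonneg _), abs_of_nonneg (by positivity),
    NNReal.coe_one, one_mul] at h2
  calc η * softPos ((a - b) / η) ≤ η * (d / η) := by gcongr; exact h1.trans h2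
    _ = d := by field_simp

/-- The smooth maximum inherits lower bounds on second differences, because it is convex,
nondecreasing in both variables and commutes with the addition of constants. -/
theorem softMax_secondDiff {η μ a a₁ a₂ b b₁ b₂ : ℝ} (hη : 0 < η)
    (ha : μ ≤ a₁ + a₂ - 2 * a) (hb : μ ≤ b₁ + b₂ - 2 * b) :
    μ ≤ softMax η a₁ b₁ + softMax η a₂ b₂ - 2 * softMax η a b := by
  unfold softMax
  set s₁ := (a₁ - b₁) / η
  set s₂ := (a₂ - b₂) / η
  set s := (a - b) / η
  have hconv : 2 * softPos ((s₁ + s₂) / 2) ≤ softPos s₁ + softPos s₂ := by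
    have := convexOn_softPos.2 (mem_univ s₁) (mem_univ s₂) (by norm_num : (0 : ℝ) ≤ 1 / 2)
      (by norm_num : (0 : ℝ) ≤ 1 / 2) (by norm_num)
    simp only [smul_eq_mul] at this
    rw [show (s₁ + s₂) / 2 = 1 / 2 * s₁ + 1 / 2 * s₂ by ring]
    linarith
  set m := (s₁ + s₂) / 2
  have e1 : 2 * (η * m) = (a₁ + a₂) - (b₁ + b₂) := by
    simp only [m, s₁, s₂]; field_simp; ring
  have e2 : η * s = a - b := by simp only [s]; field_simp
  -- `θ` is nondecreasing with slope at most one, so `θ s - θ m` is at most `max (s - m) 0`.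
  have hle : softPos s - softPos m ≤ max (s - m) 0 := by
    rcases le_total s m with h | h
    · exact le_max_of_le_right (by linarith [softPos_mono h])
    · refine le_max_of_le_left ?_
      have := lipschitzWith_softPos.dist_le_mul s m
      rw [Real.dist_eq, Real.dist_eq, NNReal.coe_one, one_mul, abs_of_nonneg (sub_nonneg.2 h)]
        at this
      exact (le_abs_self _).trans this
  have h3 : η * (2 * softPos m) ≤ η * (softPos s₁ + softPos s₂) := by gcongr
  have h4 : η * (softPos s - softPos m) ≤ η * max (s - m) 0 := by gcongr
  rcases max_cases (s - m) 0 with ⟨h5, _⟩ | ⟨h5, _⟩ <;> rw [h5] at h4 <;> nlinarith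

/-! ### Second differences along solutions of second order equations -/

section SecondOrder

variable {E : Type*} [NormedAddCommGroup E] [NormedSpace ℝ E]

/-- The curve `β` in `E × E` solves, on the open interval `(-τ, τ)`, the first order system of the
second order equation `ξ'' = Γ(ξ, ξ')`, and stays in `W`. -/
def IsSolutionIn (Γ : E × E → E) (W : Set (E × E)) (τ : ℝ) (β : ℝ → E × E) : Prop :=
  ∀ t ∈ Ioo (-τ) τ, β t ∈ W ∧ HasDerivAt β ((β t).2, Γ (β t)) t

theorem IsSolutionIn.mono {Γ : E × E → E} {W W' : Set (E × E)} {τ τ' : ℝ} {β : ℝ → E × E}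
    (h : IsSolutionIn Γ W τ β) (hW : W ⊆ W') (hτ : τ' ≤ τ) : IsSolutionIn Γ W' τ' β :=
  fun t ht => ⟨hW (h t ⟨by linarith [ht.1], by linarith [ht.2]⟩).1,
    (h t ⟨by linarith [ht.1], by linarith [ht.2]⟩).2⟩

theorem IsSolutionIn.exists_mem {Γ : E × E → E} {W W' : Set (E × E)} {τ : ℝ} {β : ℝ → E × E}
    (h : IsSolutionIn Γ W τ β) (hτ : 0 < τ) (hW : W' ∈ 𝓝 (β 0)) :
    ∃ τ' > 0, τ' ≤ τ ∧ IsSolutionIn Γ W' τ' β := by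
  have hc : ContinuousAt β 0 := (h 0 ⟨by linarith, hτ⟩).2.continuousAt
  obtain ⟨ε, hε, hb⟩ := Metric.mem_nhds_iff.1 (hc.preimage_mem_nhds hW)
  refine ⟨min ε τ, lt_min hε hτ, min_le_right _ _, fun t ht => ⟨hb ?_, (h t ?_).2⟩⟩
  · rw [Metric.mem_ball, dist_zero_right, Real.norm_eq_abs, abs_lt]
    exact ⟨by linarith [ht.1, min_le_left ε τ], by linarith [ht.2, min_le_left ε τ]⟩
  · exact ⟨by linarith [ht.1, min_le_right ε τ], by linarith [ht.2, min_le_right ε τ]⟩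

theorem IsSolutionIn.hasDerivAt_fst {Γ : E × E → E} {W : Set (E × E)} {τ : ℝ} {β : ℝ → E × E}
    (h : IsSolutionIn Γ W τ β) {t : ℝ} (ht : t ∈ Ioo (-τ) τ) :
    HasDerivAt (fun s => (β s).1) (β t).2 t := (h t ht).2.fst

theorem IsSolutionIn.hasDerivAt_snd {Γ : E × E → E} {W : Set (E × E)} {τ : ℝ} {β : ℝ → E × E}
    (h : IsSolutionIn Γ W τ β) {t : ℝ} (ht : t ∈ Ioo (-τ) τ) :
    HasDerivAt (fun s => (β s).2) (Γ (β t)) t := (h t ht).2.snd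

/-- Local existence with uniform time, the solutions staying in a prescribed neighbourhood. -/
theorem exists_isSolutionIn [CompleteSpace E] {Γ : E × E → E} {p₀ : E × E}
    (hΓ : ContDiffAt ℝ 1 Γ p₀) {W : Set (E × E)} (hW : W ∈ 𝓝 p₀) :
    ∃ r > 0, ∃ τ > 0, ∀ p ∈ Metric.closedBall p₀ r,
      ∃ α : ℝ → E × E, α 0 = p ∧ IsSolutionIn Γ W τ α := by
  have hV : ContDiffAt ℝ 1 (fun p : E × E => (p.2, Γ p)) p₀ := contDiffAt_snd.prodMk hΓ
  obtain ⟨ε, hε, a, r, L, K, hr, hpl⟩ := IsPicardLindelof.of_contDiffAt_one hV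
  obtain ⟨w, hw, hball⟩ := Metric.mem_nhds_iff.1 hW
  -- A smaller ball `a'`, contained in `W`, confines the solutions.
  set a' : ℝ≥0 := min a (Real.toNNReal (w / 2)) with ha'
  have ha0 : 0 < a := by
    have h1 := (hpl 0).mul_max_le
    have h2 : (0 : ℝ) ≤ L * max (0 + ε - 0) (0 - (0 - ε)) := by
      have : 0 ≤ max (0 + ε - 0) (0 - (0 - ε)) := le_max_of_le_left (by linarith)
      positivity
    have h3 : (r : ℝ) ≤ a := by
      have := h2.trans h1
      linarith
    exact lt_of_lt_of_le hr (by exact_mod_cast h3)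
  have ha'0 : 0 < a' := lt_min ha0 (Real.toNNReal_pos.2 (by positivity))
  have ha'w : (a' : ℝ) < w := by
    have : a' ≤ (Real.toNNReal (w / 2)) := min_le_right _ _
    have h4 : (a' : ℝ) ≤ w / 2 := by
      rw [← Real.coe_toNNReal (w / 2) (by positivity)]
      exact_mod_cast this
    linarith
  obtain ⟨ε', hε', hpl'⟩ := (hpl 0).exists_shrink_radius hε (a' := a') (r' := a' / 2)
    (min_le_left _ _) (NNReal.half_lt_self ha'0.ne')
  refine ⟨(a' / 2 : ℝ≥0), by positivity, ε', hε', fun p hp => ?_⟩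
  obtain ⟨α, hα⟩ := ODE.FunSpace.exists_isFixedPt_next hpl' hp
  refine ⟨α.compProj, ?_, fun t ht => ⟨?_, ?_⟩⟩
  · have : α.compProj ((⟨0, by simp [hε'.le]⟩ : Icc (0 - ε') (0 + ε')) : ℝ) = p := by
      rw [ODE.FunSpace.compProj_val, ← hα, ODE.FunSpace.next_apply₀]
    exact this
  · exact hball (Metric.closedBall_subset_ball ha'w
      (α.compProj_mem_closedBall hpl'.mul_max_le))
  · have htI : t ∈ Icc (0 - ε') (0 + ε') := ⟨by linarith [ht.1], by linarith [ht.2]⟩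
    have hd : HasDerivWithinAt α.compProj ((α.compProj t).2, Γ (α.compProj t))
        (Icc (0 - ε') (0 + ε')) t := by
      apply ODE.hasDerivWithinAt_picard_Icc (f := fun _ p => (p.2, Γ p)) (t₀ := 0) (x₀ := p)
        (by simp [hε'.le]) hpl'.continuousOn_uncurry α.continuous_compProj.continuousOn
        (fun _ _ => α.compProj_mem_closedBall hpl'.mul_max_le) htI |>.congr_of_mem _ htI
      intro s hs
      nth_rw 1 [← hα]
      rw [ODE.FunSpace.compProj_of_mem hs, ODE.FunSpace.next_apply]
    exact hd.hasDerivAt (Icc_mem_nhds (by linarith [ht.1]) (by linarith [ht.2]))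

/-- Two solutions with initial points `(x, y)` and `(x - z, y)` differ by the translation `z` up to
an error `O((‖z‖ + |r|) r²)`. -/
theorem norm_sub_sub_le_of_isSolutionIn {Γ : E × E → E} {W : Set (E × E)} {τ : ℝ}
    {β α : ℝ → E × E} (hβ : IsSolutionIn Γ W τ β) (hα : IsSolutionIn Γ W τ α) {z : E}
    (h0 : α 0 = β 0 - (z, 0)) {K : ℝ≥0} (hK : LipschitzOnWith K Γ W) {C : ℝ}
    (hC : ∀ p ∈ W, ‖(p.2, Γ p)‖ ≤ C) {r : ℝ} (hr : r ∈ Ioo (-τ) τ) :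
    ‖(β r).1 - z - (α r).1‖ ≤ K * (‖z‖ + 2 * C * |r|) * r ^ 2 := by
  have hmem : ∀ t, |t| ≤ |r| → t ∈ Ioo (-τ) τ := fun t ht =>
    abs_lt.1 (ht.trans_lt (abs_lt.2 hr))
  have hτ0 : (0 : ℝ) ∈ Ioo (-τ) τ := hmem 0 (by simp)
  have hC0 : 0 ≤ C := (norm_nonneg _).trans (hC _ (hβ 0 hτ0).1)
  have hmove : ∀ {γ : ℝ → E × E}, IsSolutionIn Γ W τ γ → ∀ t, |t| ≤ |r| →
      ‖γ t - γ 0‖ ≤ C * |r| := by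
    intro γ hγ t ht
    have := (convex_Icc (-|r|) |r|).norm_image_sub_le_of_norm_hasDerivWithin_le (f := γ)
      (f' := fun s => ((γ s).2, Γ (γ s))) (C := C)
      (fun x hx => (hγ x (hmem x (abs_le.2 hx))).2.hasDerivWithinAt)
      (fun x hx => hC _ (hγ x (hmem x (abs_le.2 hx))).1)
      (x := 0) (y := t) ⟨by simp, abs_nonneg r⟩ (abs_le.1 ht)
    rw [sub_zero, Real.norm_eq_abs] at this
    exact this.trans (by gcongr)
  refine norm_le_mul_sq_of_hasDerivAt (ζ := fun t => (β t).1 - z - (α t).1)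
    (ζ₁ := fun t => (β t).2 - (α t).2) (ζ₂ := fun t => Γ (β t) - Γ (α t))
    (fun t ht => ((hβ.hasDerivAt_fst (hmem t ht)).sub_const z).sub (hα.hasDerivAt_fst (hmem t ht)))
    (fun t ht => (hβ.hasDerivAt_snd (hmem t ht)).sub (hα.hasDerivAt_snd (hmem t ht)))
    (fun t ht => ?_) ?_ ?_
  · have h1 := hK.dist_le_mul _ (hβ t (hmem t ht)).1 _ (hα t (hmem t ht)).1
    rw [dist_eq_norm, dist_eq_norm] at h1
    refine h1.trans ?_
    have h2 : ‖β 0 - α 0‖ = ‖z‖ := by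
      rw [h0, sub_sub_cancel, Prod.norm_def]
      simp
    have h3 : ‖β t - α t‖ ≤ ‖z‖ + 2 * C * |r| := by
      calc ‖β t - α t‖ = ‖(β t - β 0) + (β 0 - α 0) - (α t - α 0)‖ := by congr 1; abel
        _ ≤ ‖β t - β 0‖ + ‖β 0 - α 0‖ + ‖α t - α 0‖ :=
          (norm_sub_le _ _).trans (by gcongr; exact norm_add_le _ _)
        _ ≤ C * |r| + ‖z‖ + C * |r| := by
          gcongr
          · exact hmove hβ t ht
          · exact h2.le
          · exact hmove hα t ht
        _ = _ := by ring
    gcongr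
  · simp [h0]
  · simp [h0]

/-- A smooth function has bounded second differences along solutions. -/
theorem exists_abs_secondDiff_le {Γ : E × E → E} {p₀ : E × E} (hΓ : ContinuousAt Γ p₀)
    {b : E → ℝ} (hb : ContDiff ℝ ∞ b) :
    ∃ A > 0, ∃ W ∈ 𝓝 p₀, ∀ τ > 0, ∀ β : ℝ → E × E, IsSolutionIn Γ univ τ β → β 0 ∈ W →
      ∀ᶠ r in 𝓝 (0 : ℝ), |b (β r).1 + b (β (-r)).1 - 2 * b (β 0).1| ≤ A * r ^ 2 := by
  -- First and second derivative of `b` along a solution, as functions of the phase point.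
  set Ψ : E × E → ℝ := fun p => fderiv ℝ b p.1 p.2 with hΨ
  have hΨs : ContDiff ℝ ∞ Ψ :=
    ((hb.fderiv_right (m := ∞) (by simp)).comp contDiff_fst).clm_apply contDiff_snd
  set Ψ₂ : E × E → ℝ := fun p => fderiv ℝ Ψ p (p.2, Γ p) with hΨ₂
  have hΨ₂c : ContinuousAt Ψ₂ p₀ :=
    ((hΨs.continuous_fderiv (by simp)).continuousAt).clm_apply
      (continuousAt_snd.prodMk hΓ)
  have hbd : ∀ᶠ p in 𝓝 p₀, ‖Ψ₂ p‖ < ‖Ψ₂ p₀‖ + 1 :=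
    hΨ₂c.norm.eventually_lt continuousAt_const (by linarith)
  obtain ⟨W, hW, hWo, hp⟩ := eventually_nhds_iff.1 hbd
  refine ⟨2 * (‖Ψ₂ p₀‖ + 1), by positivity, W, hWo.mem_nhds hp, fun τ hτ β hβ hβ0 => ?_⟩
  obtain ⟨τ', hτ', -, hβ'⟩ := hβ.exists_mem hτ (hWo.mem_nhds hβ0)
  filter_upwards [Ioo_mem_nhds (neg_lt_zero.2 hτ') hτ'] with r hr
  have hmem : ∀ t, |t| ≤ |r| → t ∈ Ioo (-τ') τ' := fun t ht =>
    abs_lt.1 (ht.trans_lt (abs_lt.2 hr))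
  have hd1 : ∀ t, t ∈ Ioo (-τ') τ' → HasDerivAt (fun s => b (β s).1) (Ψ (β t)) t := fun t ht =>
    (hb.differentiable (by simp) _).hasFDerivAt.comp_hasDerivAt t (hβ'.hasDerivAt_fst ht)
  have hd2 : ∀ t, t ∈ Ioo (-τ') τ' → HasDerivAt (fun s => Ψ (β s)) (Ψ₂ (β t)) t := fun t ht =>
    (hΨs.differentiable (by simp) _).hasFDerivAt.comp_hasDerivAt t (hβ' t ht).2
  have hest : ∀ s, |s| = |r| →
      ‖b (β s).1 - b (β 0).1 - s * Ψ (β 0)‖ ≤ (‖Ψ₂ p₀‖ + 1) * s ^ 2 := by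
    intro s hs
    refine norm_le_mul_sq_of_hasDerivAt (ζ := fun t => b (β t).1 - b (β 0).1 - t * Ψ (β 0))
      (ζ₁ := fun t => Ψ (β t) - Ψ (β 0)) (ζ₂ := fun t => Ψ₂ (β t)) (fun t ht => ?_)
      (fun t ht => (hd2 t (hmem t (hs ▸ ht))).sub_const _)
      (fun t ht => (hW _ (hβ' t (hmem t (hs ▸ ht))).1).le) (by simp) (by simp)
    have := ((hd1 t (hmem t (hs ▸ ht))).sub_const (b (β 0).1)).sub
      ((hasDerivAt_id t).mul_const (Ψ (β 0)))
    rw [one_mul] at this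
    exact this
  have e1 := hest r rfl
  have e2 := hest (-r) (abs_neg r)
  rw [Real.norm_eq_abs] at e1 e2
  rw [neg_sq] at e2
  have e3 := abs_add_le (b (β r).1 - b (β 0).1 - r * Ψ (β 0))
    (b (β (-r)).1 - b (β 0).1 - (-r) * Ψ (β 0))
  rw [show b (β r).1 - b (β 0).1 - r * Ψ (β 0) + (b (β (-r)).1 - b (β 0).1 - (-r) * Ψ (β 0))
    = b (β r).1 + b (β (-r)).1 - 2 * b (β 0).1 by ring] at e3
  linarith

end SecondOrder

/-! ### Convolution -/

section Convolution

open ContinuousLinearMap Convolution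

variable {E : Type*} [NormedAddCommGroup E] [InnerProductSpace ℝ E] [FiniteDimensional ℝ E]
  [MeasurableSpace E] [BorelSpace E]

/-- The mollification of `h` by the bump function `ρ`. -/
noncomputable def mollify (ρ : ContDiffBump (0 : E)) (h : E → ℝ) (x : E) : ℝ :=
  ∫ z, ρ.normed volume z * h (x - z)

theorem mollify_eq_convolution (ρ : ContDiffBump (0 : E)) (h : E → ℝ) :
    mollify ρ h = (ρ.normed volume ⋆[lsmul ℝ ℝ, volume] h) := by
  ext x
  simp [mollify, convolution]

theorem contDiff_mollify (ρ : ContDiffBump (0 : E)) {h : E → ℝ} (hh : Continuous h) :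
    ContDiff ℝ ∞ (mollify ρ h) := by
  rw [mollify_eq_convolution]
  exact ρ.hasCompactSupport_normed.contDiff_convolution_left _ ρ.contDiff_normed
    hh.locallyIntegrable

theorem abs_mollify_sub_le (ρ : ContDiffBump (0 : E)) {h : E → ℝ} {L : ℝ≥0}
    (hh : LipschitzWith L h) (x : E) : |mollify ρ h x - h x| ≤ L * ρ.rOut := by
  rw [mollify_eq_convolution, ← Real.dist_eq]
  refine ContDiffBump.dist_normed_convolution_le hh.continuous.aestronglyMeasurable ?_
  intro y hy
  refine (hh.dist_le_mul y x).trans ?_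
  gcongr
  exact (Metric.mem_ball.1 hy).le

theorem integrable_normed_mul (ρ : ContDiffBump (0 : E)) {h : E → ℝ} (hh : Continuous h) (x : E) :
    Integrable fun z => ρ.normed volume z * h (x - z) := by
  refine Continuous.integrable_of_hasCompactSupport ?_ ?_
  · exact ρ.continuous_normed.mul (by fun_prop)
  · exact ρ.hasCompactSupport_normed.mul_right

theorem le_secondDiff_mollify (ρ : ContDiffBump (0 : E)) {h : E → ℝ} (hh : Continuous h)
    {x x₁ x₂ : E} {μ : ℝ}
    (H : ∀ z, ‖z‖ < ρ.rOut → μ ≤ h (x₁ - z) + h (x₂ - z) - 2 * h (x - z)) :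
    μ ≤ mollify ρ h x₁ + mollify ρ h x₂ - 2 * mollify ρ h x := by
  have i1 := integrable_normed_mul ρ hh x₁
  have i2 := integrable_normed_mul ρ hh x₂
  have i0 := (integrable_normed_mul ρ hh x).const_mul 2
  have hint : mollify ρ h x₁ + mollify ρ h x₂ - 2 * mollify ρ h x
      = ∫ z, (ρ.normed volume z * h (x₁ - z) + ρ.normed volume z * h (x₂ - z)
          - 2 * (ρ.normed volume z * h (x - z))) := by
    have e1 := integral_sub (i1.add i2) i0
    have e2 := integral_add i1 i2
    simp only [Pi.add_apply] at e1
    rw [e1, e2, integral_const_mul]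
    rfl
  have hμ : μ = ∫ z, ρ.normed volume z * μ := by
    rw [integral_mul_const, ρ.integral_normed, one_mul]
  rw [hint, hμ]
  refine integral_mono ?_ ((i1.add i2).sub i0) fun z => ?_
  · exact (ρ.continuous_normed.integrable_of_hasCompactSupport
      ρ.hasCompactSupport_normed).mul_const _
  · by_cases hz : ‖z‖ < ρ.rOut
    · have h1 := mul_le_mul_of_nonneg_left (H z hz) (ρ.nonneg_normed (μ := volume) z)
      simp only
      linarith
    · have : ρ.normed volume z = 0 := by
        rw [← Function.notMem_support, ρ.support_normed_eq, Metric.mem_ball, dist_zero_right]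
        exact hz
      simp [this]

/-- If a Lipschitz function `h` has second differences at least `μ r²` along the solutions of
`ξ'' = Γ(ξ, ξ')` near `p₀`, then its mollifications by sufficiently concentrated bump functions have
second differences at least `μ' r²`, for any `μ' < μ`. A translate of a solution is a solution up to
a small multiple of `r²`, which the Lipschitz constant turns into a loss in `μ`. -/
theorem exists_mollify_secondDiff {Γ : E × E → E} {p₀ : E × E} (hΓ : ContDiffAt ℝ 1 Γ p₀)
    {h : E → ℝ} {L : ℝ≥0} (hh : LipschitzWith L h) {μ μ' : ℝ} (hμ : μ' < μ)
    {W : Set (E × E)} (hW : W ∈ 𝓝 p₀)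
    (H : ∀ τ, ∀ α : ℝ → E × E, IsSolutionIn Γ W τ α → ∀ r ∈ Ioo (-τ) τ,
      μ * r ^ 2 ≤ h (α r).1 + h (α (-r)).1 - 2 * h (α 0).1) :
    ∃ σ > 0, ∃ W' ∈ 𝓝 p₀, ∀ ρ : ContDiffBump (0 : E), ρ.rOut ≤ σ → ∀ τ > 0, ∀ β : ℝ → E × E,
      IsSolutionIn Γ univ τ β → β 0 ∈ W' → ∀ᶠ r in 𝓝 (0 : ℝ),
        μ' * r ^ 2 ≤ mollify ρ h (β r).1 + mollify ρ h (β (-r)).1 - 2 * mollify ρ h (β 0).1 := by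
  obtain ⟨K, s, hs, hK⟩ := hΓ.exists_lipschitzOnWith
  set C : ℝ := ‖(p₀.2, Γ p₀)‖ + 1 with hCdef
  have hCpos : 0 < C := by positivity
  have hbd : ∀ᶠ p in 𝓝 p₀, ‖(p.2, Γ p)‖ < C :=
    (continuousAt_snd.prodMk hΓ.continuousAt).norm.eventually_lt continuousAt_const
      (by simp [hCdef])
  obtain ⟨W₀, hW₀sub, hW₀o, hp₀⟩ := mem_nhds_iff.1 (inter_mem (inter_mem hs hW) hbd)
  have hK' : LipschitzOnWith K Γ W₀ := hK.mono fun p hp => (hW₀sub hp).1.1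
  have hC' : ∀ p ∈ W₀, ‖(p.2, Γ p)‖ ≤ C := fun p hp => le_of_lt (hW₀sub hp).2
  obtain ⟨d, hd, ε, hε, hflow⟩ := exists_isSolutionIn hΓ (hW₀o.mem_nhds hp₀)
  -- `σ` bounds both the displacement and the loss `2 L K (σ + 2 C |r|)` for small `r`.
  set m : ℝ := (μ - μ') / (4 * (L + 1) * (K + 1)) with hm
  have hmpos : 0 < m := div_pos (by linarith) (by positivity)
  refine ⟨min (d / 2) m, lt_min (by positivity) hmpos, Metric.ball p₀ (d / 2) ∩ W₀,
    inter_mem (Metric.ball_mem_nhds _ (by positivity)) (hW₀o.mem_nhds hp₀), ?_⟩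
  intro ρ hρ τ hτ β hβ hβ0
  obtain ⟨τ', hτ', -, hβ'⟩ := hβ.exists_mem hτ (hW₀o.mem_nhds hβ0.2)
  set τ₁ := min (min τ' ε) (m / (2 * C)) with hτ₁
  have hτ₁pos : 0 < τ₁ := lt_min (lt_min hτ' hε) (by positivity)
  filter_upwards [Ioo_mem_nhds (neg_lt_zero.2 hτ₁pos) hτ₁pos] with r hr
  refine le_secondDiff_mollify ρ hh.continuous fun z hz => ?_
  have hzd : ‖z‖ ≤ d / 2 := hz.le.trans (hρ.trans (min_le_left _ _))
  have hzm : ‖z‖ ≤ m := hz.le.trans (hρ.trans (min_le_right _ _))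
  obtain ⟨α, hα0, hα⟩ := hflow (β 0 - (z, 0)) (by
    rw [Metric.mem_closedBall, dist_eq_norm]
    have h1 : ‖β 0 - p₀‖ < d / 2 := by simpa [dist_eq_norm] using hβ0.1
    have h2 : ‖((z, 0) : E × E)‖ = ‖z‖ := by simp [Prod.norm_def]
    calc ‖β 0 - (z, 0) - p₀‖ = ‖(β 0 - p₀) - (z, 0)‖ := by congr 1; abel
      _ ≤ ‖β 0 - p₀‖ + ‖((z, 0) : E × E)‖ := norm_sub_le _ _
      _ ≤ d := by rw [h2]; linarith)
  have hβ₁ : IsSolutionIn Γ W₀ τ₁ β :=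
    hβ'.mono Subset.rfl ((min_le_left _ _).trans (min_le_left _ _))
  have hα₁ : IsSolutionIn Γ W₀ τ₁ α :=
    hα.mono Subset.rfl ((min_le_left _ _).trans (min_le_right _ _))
  have hr' : -r ∈ Ioo (-τ₁) τ₁ := ⟨by linarith [hr.2], by linarith [hr.1]⟩
  have e0 := H τ₁ α (hα₁.mono (fun p hp => (hW₀sub hp).1.2) le_rfl) r hr
  have hloss : ∀ s, |s| = |r| → s ∈ Ioo (-τ₁) τ₁ →
      h (α s).1 - (μ - μ') / 2 * r ^ 2 ≤ h ((β s).1 - z) := by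
    intro s hs hsI
    have e1 := norm_sub_sub_le_of_isSolutionIn hβ₁ hα₁ hα0 hK' hC' hsI
    have e2 := hh.dist_le_mul ((β s).1 - z) (α s).1
    rw [Real.dist_eq, dist_eq_norm] at e2
    have e3 : |s| ≤ m / (2 * C) := by
      rw [hs]; exact (abs_lt.2 hr).le.trans (min_le_right _ _)
    have e4 : 2 * C * |s| ≤ m := by
      calc 2 * C * |s| ≤ 2 * C * (m / (2 * C)) := by gcongr
        _ = m := by field_simp
    have hs2 : s ^ 2 = r ^ 2 := by rw [← sq_abs s, hs, sq_abs]
    have e5 : (L : ℝ) * ‖(β s).1 - z - (α s).1‖ ≤ (μ - μ') / 2 * r ^ 2 := by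
      calc (L : ℝ) * ‖(β s).1 - z - (α s).1‖
          ≤ (L + 1) * ((K + 1) * (m + m) * r ^ 2) := by
            rw [hs2] at e1
            gcongr
            · linarith
            · refine e1.trans ?_
              gcongr
              linarith
        _ = (μ - μ') / 2 * r ^ 2 := by rw [hm]; field_simp; ring
    have e6 := neg_abs_le (h ((β s).1 - z) - h (α s).1)
    linarith
  have e1 := hloss r rfl hr
  have e2 := hloss (-r) (abs_neg r) hr'
  have e3 : (α 0).1 = (β 0).1 - z := by rw [hα0]; simp
  rw [← e3]
  linarith

end Convolution

/-! ### Euler–Lagrange expressions -/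

section EulerLagrange

variable {E : Type*} [NormedAddCommGroup E] [NormedSpace ℝ E]

/-- The Euler–Lagrange expression `(d/dt) L_y(x, x') - L_x(x, x')` of a Lagrangian `L(x, y)`, in the
direction `w`, for a curve with position and velocity `p = (x, x')` and acceleration `a = x''`. -/
noncomputable def eulerLagrange (L : E × E → ℝ) (p : E × E) (a w : E) : ℝ :=
  fderiv ℝ (fderiv ℝ L) p (p.2, a) (0, w) - fderiv ℝ L p (w, 0)

/-- The Euler–Lagrange expression transforms as a covector under a change of coordinates `T`, the
velocity and the acceleration being transformed like those of a curve. -/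
theorem eulerLagrange_comp {L L' : E × E → ℝ} {T : E → E} {p : E × E}
    (hT : ContDiffAt ℝ 2 T p.1) (hLc : ContDiffAt ℝ 2 L p)
    (hL' : ContDiffAt ℝ 2 L' (T p.1, fderiv ℝ T p.1 p.2))
    (hL : L =ᶠ[𝓝 p] fun q => L' (T q.1, fderiv ℝ T q.1 q.2)) (a w : E) :
    eulerLagrange L p a w = eulerLagrange L' (T p.1, fderiv ℝ T p.1 p.2)
      (fderiv ℝ (fderiv ℝ T) p.1 p.2 p.2 + fderiv ℝ T p.1 a) (fderiv ℝ T p.1 w) := by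
  set Φ : E × E → E × E := fun q => (T q.1, fderiv ℝ T q.1 q.2) with hΦ
  have hΦd : ∀ q : E × E, ContDiffAt ℝ 2 T q.1 → HasFDerivAt Φ
      (((fderiv ℝ T q.1).comp (ContinuousLinearMap.fst ℝ E E)).prod
        ((fderiv ℝ T q.1).comp (ContinuousLinearMap.snd ℝ E E) +
          ((fderiv ℝ (fderiv ℝ T) q.1).comp (ContinuousLinearMap.fst ℝ E E)).flip q.2)) q := by
    intro q hq
    have h1 : HasFDerivAt T (fderiv ℝ T q.1) q.1 := (hq.differentiableAt (by simp)).hasFDerivAt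
    have h2 : HasFDerivAt (fderiv ℝ T) (fderiv ℝ (fderiv ℝ T) q.1) q.1 :=
      ((hq.fderiv_right (m := 1) (by norm_num)).differentiableAt (by simp)).hasFDerivAt
    exact (h1.comp q hasFDerivAt_fst).prodMk ((h2.comp q hasFDerivAt_fst).clm_apply hasFDerivAt_snd)
  have hΦc : ContinuousAt Φ p := (hΦd p hT).continuousAt
  have evT : ∀ᶠ q in 𝓝 p, ContDiffAt ℝ 2 T q.1 :=
    continuousAt_fst.eventually (hT.eventually (by simp))
  have evL' : ∀ᶠ q in 𝓝 p, ContDiffAt ℝ 2 L' (Φ q) :=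
    hΦc.eventually (hL'.eventually (by simp))
  have hfd : ∀ᶠ q in 𝓝 p, ∀ v : E × E, fderiv ℝ L q v = fderiv ℝ L' (Φ q)
      (fderiv ℝ T q.1 v.1, fderiv ℝ T q.1 v.2 + fderiv ℝ (fderiv ℝ T) q.1 v.1 q.2) := by
    filter_upwards [hL.eventuallyEq_nhds, evT, evL'] with q h1 h2 h3 v
    rw [h1.fderiv_eq]
    have := ((h3.differentiableAt (by simp)).hasFDerivAt.comp q (hΦd q h2)).fderiv
    rw [show (fun q => L' (T q.1, fderiv ℝ T q.1 q.2)) = L' ∘ Φ from rfl, this]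
    simp
  have h0 : (fun q => fderiv ℝ L q (0, w)) =ᶠ[𝓝 p]
      fun q => fderiv ℝ L' (Φ q) (0, fderiv ℝ T q.1 w) := by
    filter_upwards [hfd] with q hq
    simp [hq]
  have hLs : ContDiffAt ℝ 2 L' (Φ p) := hL'
  have hd1 : HasFDerivAt (fun q => fderiv ℝ L' (Φ q)) _ p :=
    ((hLs.fderiv_right (m := 1) (by norm_num)).differentiableAt (by simp)).hasFDerivAt.comp p
      (hΦd p hT)
  have hd2 : HasFDerivAt (fun q : E × E => fderiv ℝ T q.1 w)
      (((fderiv ℝ (fderiv ℝ T) p.1).comp (ContinuousLinearMap.fst ℝ E E)).flip w) p :=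
    by
      have h2 : HasFDerivAt (fderiv ℝ T) (fderiv ℝ (fderiv ℝ T) p.1) p.1 :=
        ((hT.fderiv_right (m := 1) (by norm_num)).differentiableAt (by simp)).hasFDerivAt
      have := (h2.comp p hasFDerivAt_fst).clm_apply (hasFDerivAt_const w p)
      simpa using this
  have hd3 := hd1.clm_apply ((hasFDerivAt_const (0 : E) p).prodMk hd2)
  have hLd : DifferentiableAt ℝ (fderiv ℝ L) p :=
    (hLc.fderiv_right (m := 1) (by norm_num)).differentiableAt (by simp)
  have hs : fderiv ℝ (fderiv ℝ L) p (p.2, a) (0, w) =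
      fderiv ℝ (fun q => fderiv ℝ L q (0, w)) p (p.2, a) := by
    have := (hLd.hasFDerivAt.clm_apply (hasFDerivAt_const ((0 : E), w) p)).fderiv
    rw [this]
    simp
  have hsymm : fderiv ℝ (fderiv ℝ T) p.1 w p.2 = fderiv ℝ (fderiv ℝ T) p.1 p.2 w :=
    (hT.isSymmSndFDerivAt (by simp)).eq _ _
  rw [eulerLagrange, eulerLagrange, hs, h0.fderiv_eq, hd3.fderiv, hfd.self_of_nhds]
  have hadd : fderiv ℝ L' (Φ p) (fderiv ℝ T p.1 w, fderiv ℝ (fderiv ℝ T) p.1 p.2 w)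
      = fderiv ℝ L' (Φ p) (fderiv ℝ T p.1 w, 0) +
        fderiv ℝ L' (Φ p) (0, fderiv ℝ (fderiv ℝ T) p.1 p.2 w) := by
    rw [← map_add]; simp
  have hΦp : (T p.1, (fderiv ℝ T p.1) p.2) = Φ p := rfl
  rw [hΦp]
  simp only [hsymm, map_zero, zero_add, hadd, _root_.add_apply,
    ContinuousLinearMap.comp_apply, ContinuousLinearMap.flip_apply, ContinuousLinearMap.prod_apply,
    ContinuousLinearMap.coe_fst', ContinuousLinearMap.coe_snd', _root_.zero_apply]
  rw [add_comm (fderiv ℝ T p.1 a)]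
  ring

theorem lineDeriv_snd {G : E × E → ℝ} {x y : E} (hG : DifferentiableAt ℝ G (x, y)) (w : E) :
    lineDeriv ℝ (fun y' => G (x, y')) y w = fderiv ℝ G (x, y) (0, w) := by
  have := ((hG.hasFDerivAt.comp y (hasFDerivAt_prodMk_right x y)).hasLineDerivAt w).lineDeriv
  rw [ContinuousLinearMap.comp_apply, ContinuousLinearMap.inr_apply] at this
  exact this

theorem lineDeriv_fst {G : E × E → ℝ} {x y : E} (hG : DifferentiableAt ℝ G (x, y)) (w : E) :
    lineDeriv ℝ (fun x' => G (x', y)) x w = fderiv ℝ G (x, y) (w, 0) := by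
  have := ((HasFDerivAt.comp (f := fun x' => (x', y)) x hG.hasFDerivAt
    (hasFDerivAt_prodMk_left x y)).hasLineDerivAt w).lineDeriv
  rw [ContinuousLinearMap.comp_apply, ContinuousLinearMap.inl_apply] at this
  exact this

theorem eventually_lineDeriv_snd {G : E × E → ℝ} {p : E × E} (hG : ContDiffAt ℝ 2 G p) (w : E) :
    ∀ᶠ q in 𝓝 p, lineDeriv ℝ (fun y' => G (q.1, y')) q.2 w = fderiv ℝ G q (0, w) := by
  filter_upwards [hG.eventually (by simp)] with q hq
  exact lineDeriv_snd (hq.differentiableAt (by simp)) w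

theorem hasFDerivAt_fderiv_apply {G : E × E → ℝ} {p : E × E} (hG : ContDiffAt ℝ 2 G p)
    (v : E × E) : HasFDerivAt (fun q => fderiv ℝ G q v) ((fderiv ℝ (fderiv ℝ G) p).flip v) p := by
  have h1 := ((hG.fderiv_right (m := 1) (by norm_num)).differentiableAt (by simp)).hasFDerivAt
  have := h1.clm_apply (hasFDerivAt_const v p)
  simpa using this

theorem lineDeriv_snd_lineDeriv_snd {G : E × E → ℝ} {x y : E} (hG : ContDiffAt ℝ 2 G (x, y))
    (u w : E) : lineDeriv ℝ (fun y' => lineDeriv ℝ (fun y'' => G (x, y'')) y' w) y u =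
      fderiv ℝ (fderiv ℝ G) (x, y) (0, u) (0, w) := by
  have h1 := (Continuous.prodMk_right x).tendsto y |>.eventually (eventually_lineDeriv_snd hG w)
  have h2 := hasFDerivAt_fderiv_apply hG ((0 : E), w)
  rw [Filter.EventuallyEq.lineDeriv_eq (f := fun y' => fderiv ℝ G (x, y') (0, w)) h1,
    lineDeriv_snd h2.differentiableAt, h2.fderiv]
  rfl

theorem lineDeriv_fst_lineDeriv_snd {G : E × E → ℝ} {x y : E} (hG : ContDiffAt ℝ 2 G (x, y))
    (u w : E) : lineDeriv ℝ (fun x' => lineDeriv ℝ (fun y' => G (x', y')) y w) x u =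
      fderiv ℝ (fderiv ℝ G) (x, y) (u, 0) (0, w) := by
  have h1 := (Continuous.prodMk_left y).tendsto x |>.eventually (eventually_lineDeriv_snd hG w)
  have h2 := hasFDerivAt_fderiv_apply hG ((0 : E), w)
  rw [Filter.EventuallyEq.lineDeriv_eq (f := fun x' => fderiv ℝ G (x', y) (0, w)) h1,
    lineDeriv_fst h2.differentiableAt, h2.fderiv]
  rfl

end EulerLagrange

/-! ### The Finsler function in local coordinates -/

section InChart

variable {n : ℕ} {M : Type*} [TopologicalSpace M] [ChartedSpace (EuclideanSpace ℝ (Fin n)) M]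
  {φ : OpenPartialHomeomorph M (EuclideanSpace ℝ (Fin n))}

theorem mdifferentiableAt_symm (hφ : φ ∈ IsManifold.maximalAtlas (𝓡 n) ∞ M)
    {x : EuclideanSpace ℝ (Fin n)} (hx : x ∈ φ.target) :
    MDifferentiableAt (𝓡 n) (𝓡 n) φ.symm x :=
  ((contMDiffOn_symm_of_mem_maximalAtlas hφ).contMDiffAt
    (φ.open_target.mem_nhds hx)).mdifferentiableAt (by simp)

theorem mdifferentiableAt_chart (hφ : φ ∈ IsManifold.maximalAtlas (𝓡 n) ∞ M)
    {p : M} (hp : p ∈ φ.source) : MDifferentiableAt (𝓡 n) (𝓡 n) φ p :=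
  ((contMDiffOn_of_mem_maximalAtlas hφ).contMDiffAt
    (φ.open_source.mem_nhds hp)).mdifferentiableAt (by simp)

theorem mk_mfderiv_congr {E : Type*} [NormedAddCommGroup E] [NormedSpace ℝ E] {f g : E → M} {x : E}
    (h : f =ᶠ[𝓝 x] g) (v : E) :
    (⟨f x, mfderiv 𝓘(ℝ, E) (𝓡 n) f x v⟩ : TangentBundle (𝓡 n) M) =
      ⟨g x, mfderiv 𝓘(ℝ, E) (𝓡 n) g x v⟩ :=
  Bundle.TotalSpace.ext h.eq_of_nhds (heq_of_eq (DFunLike.congr_fun h.mfderiv_eq v))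

theorem velocity_congr {γ γ' : ℝ → M} {t : ℝ} (h : γ =ᶠ[𝓝 t] γ') :
    (velocity γ t : TangentBundle (𝓡 n) M) = velocity γ' t :=
  mk_mfderiv_congr h 1

theorem mfderiv_symm_injective (hφ : φ ∈ IsManifold.maximalAtlas (𝓡 n) ∞ M)
    {x : EuclideanSpace ℝ (Fin n)} (hx : x ∈ φ.target) :
    Function.Injective (mfderiv (𝓡 n) (𝓡 n) φ.symm x) := by
  have h1 := mfderiv_comp x (mdifferentiableAt_chart hφ (φ.map_target hx))
    (mdifferentiableAt_symm hφ hx)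
  have h2 : (φ ∘ φ.symm) =ᶠ[𝓝 x] id := by
    filter_upwards [φ.open_target.mem_nhds hx] with z hz using φ.right_inv hz
  rw [h2.mfderiv_eq, mfderiv_id] at h1
  intro u v huv
  have h3 := congrArg (mfderiv (𝓡 n) (𝓡 n) φ (φ.symm x)) huv
  have h4 := fun w => (DFunLike.congr_fun h1 w)
  exact (h4 u).trans (h3.trans (h4 v).symm)

variable [IsManifold (𝓡 n) ∞ M] (F : FinslerMetric n M)

theorem contMDiff_mk_tangentBundle (E : Type*) [NormedAddCommGroup E] [NormedSpace ℝ E] :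
    ContMDiff 𝓘(ℝ, E × E) 𝓘(ℝ, E).tangent ∞
      (fun p : E × E => (⟨p.1, p.2⟩ : TangentBundle 𝓘(ℝ, E) E)) := by
  intro p
  refine (Bundle.contMDiffAt_totalSpace).2 ⟨?_, ?_⟩
  · exact contDiff_fst.contMDiff.contMDiffAt
  · refine ContMDiffAt.congr_of_eventuallyEq (f := Prod.snd) ?_ ?_
    · exact contDiff_snd.contMDiff.contMDiffAt
    · exact Eventually.of_forall fun q => by simp

theorem contDiffOn_inChart (hφ : φ ∈ IsManifold.maximalAtlas (𝓡 n) ∞ M) :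
    ContDiffOn ℝ ∞ (fun p : EuclideanSpace ℝ (Fin n) × EuclideanSpace ℝ (Fin n) =>
      F.inChart φ p.1 p.2) (φ.target ×ˢ {0}ᶜ) := by
  have h1 : ContMDiffOn (𝓡 n).tangent (𝓡 n).tangent ∞ (tangentMapWithin (𝓡 n) (𝓡 n) φ.symm φ.target)
      (Bundle.TotalSpace.proj ⁻¹' φ.target) :=
    (contMDiffOn_symm_of_mem_maximalAtlas hφ).contMDiffOn_tangentMapWithin (m := ∞) (by simp)
      φ.open_target.uniqueMDiffOn
  have h2 := h1.comp ((contMDiff_mk_tangentBundle (EuclideanSpace ℝ (Fin n))).contMDiffOn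
    (s := (φ.target ×ˢ {0}ᶜ))) (fun p hp => hp.1)
  have h3 : ∀ p ∈ φ.target ×ˢ ({0}ᶜ : Set (EuclideanSpace ℝ (Fin n))),
      mfderivWithin (𝓡 n) (𝓡 n) φ.symm φ.target p.1 = mfderiv (𝓡 n) (𝓡 n) φ.symm p.1 :=
    fun p hp => mfderivWithin_of_isOpen φ.open_target hp.1
  have h4 := F.smooth.comp h2 (fun p hp h => hp.2 (by
    change mfderivWithin (𝓡 n) (𝓡 n) φ.symm φ.target p.1 p.2 = 0 at h
    rw [h3 p hp] at h
    exact mfderiv_symm_injective hφ hp.1 (h.trans (map_zero _).symm)))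
  refine (h4.congr fun p hp => ?_).contDiffOn
  change _ = F.toFun ⟨φ.symm p.1, mfderivWithin (𝓡 n) (𝓡 n) φ.symm φ.target p.1 p.2⟩
  rw [h3 p hp]
  rfl

theorem inChart_smul (x y : EuclideanSpace ℝ (Fin n)) {t : ℝ} (ht : 0 ≤ t) :
    F.inChart φ x (t • y) = t * F.inChart φ x y := by
  have h := F.homogeneous (φ.symm x) (mfderiv (𝓡 n) (𝓡 n) φ.symm x y) t ht
  have h2 : mfderiv (𝓡 n) (𝓡 n) φ.symm x (t • y) = t • mfderiv (𝓡 n) (𝓡 n) φ.symm x y :=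
    (mfderiv (𝓡 n) (𝓡 n) φ.symm x).map_smul t y
  exact (congrArg (fun v => F.toFun ⟨φ.symm x, v⟩) h2).trans h

theorem lineDeriv_comp_linearMap {V W : Type*} [AddCommGroup V] [Module ℝ V] [AddCommGroup W]
    [Module ℝ W] (A : V →ₗ[ℝ] W) (g : W → ℝ) (v u : V) :
    lineDeriv ℝ (fun v' => g (A v')) v u = lineDeriv ℝ g (A v) (A u) := by
  simp [lineDeriv]

theorem fundamentalTensor_comp_linearMap {V W : Type*} [AddCommGroup V] [Module ℝ V]
    [AddCommGroup W] [Module ℝ W] (A : V →ₗ[ℝ] W) (N : W → ℝ) (v u w : V) :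
    fundamentalTensor (fun v' => N (A v')) v u w = fundamentalTensor N (A v) (A u) (A w) := by
  unfold fundamentalTensor
  rw [← lineDeriv_comp_linearMap A]
  congr 2
  ext v'
  exact lineDeriv_comp_linearMap A (fun z => N z ^ 2) v' w

/-- Euler's relation `g_v(v, v) = N(v)²`. -/
theorem fundamentalTensor_self {V : Type*} [AddCommGroup V] [Module ℝ V] {N : V → ℝ}
    (hN : ∀ (v : V) (t : ℝ), 0 ≤ t → N (t • v) = t * N v) (v : V) :
    fundamentalTensor N v v v = N v ^ 2 := by
  have h1 : ∀ s : ℝ, -1 < s → lineDeriv ℝ (fun v' => N v' ^ 2) (v + s • v) v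
      = 2 * (1 + s) * N v ^ 2 := by
    intro s hs
    have e : (fun t : ℝ => N (v + s • v + t • v) ^ 2) =ᶠ[𝓝 0]
        fun t => (1 + s + t) ^ 2 * N v ^ 2 := by
      have : ∀ᶠ t : ℝ in 𝓝 0, -(1 + s) < t := lt_mem_nhds (by linarith)
      filter_upwards [this] with t ht
      rw [show v + s • v + t • v = (1 + s + t) • v by rw [add_smul, add_smul, one_smul],
        hN _ _ (by linarith)]
      ring
    rw [lineDeriv, e.deriv_eq]
    have : HasDerivAt (fun t : ℝ => (1 + s + t) ^ 2 * N v ^ 2)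
        ((2 * (1 + s + 0) ^ 1 * 1) * N v ^ 2) 0 :=
      (((hasDerivAt_id (0 : ℝ)).const_add (1 + s)).pow 2).mul_const _
    rw [this.deriv]; ring
  have e : (fun s : ℝ => lineDeriv ℝ (fun v' => N v' ^ 2) (v + s • v) v) =ᶠ[𝓝 0]
      fun s => 2 * (1 + s) * N v ^ 2 := by
    filter_upwards [lt_mem_nhds (by norm_num : (-1 : ℝ) < 0)] with s hs using h1 s hs
  rw [fundamentalTensor, lineDeriv, e.deriv_eq]
  have : HasDerivAt (fun s : ℝ => 2 * (1 + s) * N v ^ 2) (2 * 1 * N v ^ 2) 0 :=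
    (((hasDerivAt_id (0 : ℝ)).const_add 1).const_mul 2).mul_const _
  rw [this.deriv]; ring

theorem toFun_pos (x : M) {v : TangentSpace (𝓡 n) x} (hv : v ≠ 0) : 0 < F.toFun ⟨x, v⟩ := by
  have h1 := F.strongly_convex x v v hv hv
  rw [fundamentalTensor_self (fun w t ht => F.homogeneous x w t ht)] at h1
  exact (F.nonneg _).lt_of_ne fun h => by rw [← h] at h1; simp at h1

theorem inChart_pos (hφ : φ ∈ IsManifold.maximalAtlas (𝓡 n) ∞ M) {x y : EuclideanSpace ℝ (Fin n)}
    (hx : x ∈ φ.target) (hy : y ≠ 0) : 0 < F.inChart φ x y :=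
  toFun_pos F _ fun h => hy (mfderiv_symm_injective hφ hx (h.trans (map_zero _).symm))

theorem fundamentalTensor_inChart_pos (hφ : φ ∈ IsManifold.maximalAtlas (𝓡 n) ∞ M)
    {x y u : EuclideanSpace ℝ (Fin n)} (hx : x ∈ φ.target) (hy : y ≠ 0) (hu : u ≠ 0) :
    0 < fundamentalTensor (F.inChart φ x) y u u := by
  have h0 : ∀ v : EuclideanSpace ℝ (Fin n), v ≠ 0 → mfderiv (𝓡 n) (𝓡 n) φ.symm x v ≠ 0 :=
    fun v hv h => hv (mfderiv_symm_injective hφ hx (h.trans (map_zero _).symm))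
  have h1 := F.strongly_convex (φ.symm x) _ _ (h0 y hy) (h0 u hu)
  have h2 := fundamentalTensor_comp_linearMap
    (mfderiv (𝓡 n) (𝓡 n) φ.symm x).toLinearMap
    (fun v' : TangentSpace (𝓡 n) (φ.symm x) => F.toFun ⟨φ.symm x, v'⟩) y u u
  exact h1.trans_eq h2.symm

/-- The velocity of a curve, read in a chart. -/
theorem inChart_deriv (hφ : φ ∈ IsManifold.maximalAtlas (𝓡 n) ∞ M) {γ : ℝ → M} {t : ℝ}
    (hγ : MDifferentiableAt 𝓘(ℝ, ℝ) (𝓡 n) γ t) (ht : γ t ∈ φ.source) :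
    F.inChart φ (φ (γ t)) (deriv (φ ∘ γ) t) = F.toFun (velocity γ t) := by
  have h1 : (φ.symm ∘ (φ ∘ γ)) =ᶠ[𝓝 t] γ := by
    filter_upwards [hγ.continuousAt.preimage_mem_nhds (φ.open_source.mem_nhds ht)] with s hs
    exact φ.left_inv hs
  rw [← velocity_congr h1]
  have h2 := mfderiv_comp t (mdifferentiableAt_symm hφ (φ.map_source ht))
    ((mdifferentiableAt_chart hφ ht).comp t hγ)
  have h3 : mfderiv 𝓘(ℝ, ℝ) (𝓡 n) (φ ∘ γ) t (1 : ℝ) = deriv (φ ∘ γ) t := by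
    rw [mfderiv_eq_fderiv]; rfl
  have h4 : mfderiv 𝓘(ℝ, ℝ) (𝓡 n) (φ.symm ∘ (φ ∘ γ)) t (1 : ℝ) =
      mfderiv (𝓡 n) (𝓡 n) φ.symm (φ (γ t)) (deriv (φ ∘ γ) t) :=
    (DFunLike.congr_fun h2 (1 : ℝ)).trans
      (congrArg (mfderiv (𝓡 n) (𝓡 n) φ.symm (φ (γ t))) h3)
  exact (congrArg (fun v => F.toFun ⟨φ.symm (φ (γ t)), v⟩) h4).symm

/-- The Finsler functions in two charts correspond to each other under the coordinate change. -/
theorem inChart_trans {ψ : OpenPartialHomeomorph M (EuclideanSpace ℝ (Fin n))}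
    (hφ : φ ∈ IsManifold.maximalAtlas (𝓡 n) ∞ M) (hψ : ψ ∈ IsManifold.maximalAtlas (𝓡 n) ∞ M)
    {x : EuclideanSpace ℝ (Fin n)} (hx : x ∈ φ.target) (hx' : φ.symm x ∈ ψ.source)
    (y : EuclideanSpace ℝ (Fin n)) :
    F.inChart φ x y = F.inChart ψ (ψ (φ.symm x)) (fderiv ℝ (ψ ∘ φ.symm) x y) := by
  have h1 : (ψ.symm ∘ (ψ ∘ φ.symm)) =ᶠ[𝓝 x] φ.symm := by
    filter_upwards [(φ.continuousAt_symm hx).preimage_mem_nhds (ψ.open_source.mem_nhds hx')]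
      with s hs
    exact ψ.left_inv hs
  have h2 := mfderiv_comp x (mdifferentiableAt_symm hψ (ψ.map_source hx'))
    ((mdifferentiableAt_chart hψ hx').comp x (mdifferentiableAt_symm hφ hx))
  have h3 : mfderiv (𝓡 n) (𝓡 n) (ψ ∘ φ.symm) x y = fderiv ℝ (ψ ∘ φ.symm) x y := by
    rw [mfderiv_eq_fderiv]; rfl
  have h4 : mfderiv (𝓡 n) (𝓡 n) (ψ.symm ∘ (ψ ∘ φ.symm)) x y =
      mfderiv (𝓡 n) (𝓡 n) ψ.symm (ψ (φ.symm x)) (fderiv ℝ (ψ ∘ φ.symm) x y) :=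
    (DFunLike.congr_fun h2 y).trans
      (congrArg (mfderiv (𝓡 n) (𝓡 n) ψ.symm (ψ (φ.symm x))) h3)
  have h5 := congrArg F.toFun (mk_mfderiv_congr h1 y)
  exact h5.symm.trans (congrArg (fun v => F.toFun ⟨ψ.symm (ψ (φ.symm x)), v⟩) h4)

end InChart

/-! ### The geodesic spray -/

section Spray

variable {n : ℕ} {M : Type*} [TopologicalSpace M] [ChartedSpace (EuclideanSpace ℝ (Fin n)) M]
  [IsManifold (𝓡 n) ∞ M] (F : FinslerMetric n M)
  {φ : OpenPartialHomeomorph M (EuclideanSpace ℝ (Fin n))}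

/-- The Lagrangian `F²` in the local coordinates of `φ`. -/
noncomputable def FinslerMetric.lagrangian (F : FinslerMetric n M)
    (φ : OpenPartialHomeomorph M (EuclideanSpace ℝ (Fin n)))
    (p : EuclideanSpace ℝ (Fin n) × EuclideanSpace ℝ (Fin n)) : ℝ :=
  F.inChart φ p.1 p.2 ^ 2

/-- The acceleration `-2 G(x, y)` of the geodesic with position and velocity `p = (x, y)` in the
local coordinates of `φ`. -/
noncomputable def FinslerMetric.accel (F : FinslerMetric n M)
    (φ : OpenPartialHomeomorph M (EuclideanSpace ℝ (Fin n)))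
    (p : EuclideanSpace ℝ (Fin n) × EuclideanSpace ℝ (Fin n)) : EuclideanSpace ℝ (Fin n) :=
  WithLp.toLp 2 fun i => -(2 * F.spray φ p.1 p.2 i)

theorem accel_apply (p : EuclideanSpace ℝ (Fin n) × EuclideanSpace ℝ (Fin n)) (i : Fin n) :
    F.accel φ p i = -(2 * F.spray φ p.1 p.2 i) := rfl

theorem contDiffAt_inChart (hφ : φ ∈ IsManifold.maximalAtlas (𝓡 n) ∞ M)
    {p : EuclideanSpace ℝ (Fin n) × EuclideanSpace ℝ (Fin n)} (hx : p.1 ∈ φ.target)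
    (hy : p.2 ≠ 0) : ContDiffAt ℝ ∞ (fun p : EuclideanSpace ℝ (Fin n) × EuclideanSpace ℝ (Fin n) =>
      F.inChart φ p.1 p.2) p :=
  (contDiffOn_inChart F hφ).contDiffAt
    ((φ.open_target.prod isOpen_compl_singleton).mem_nhds ⟨hx, hy⟩)

theorem contDiffAt_lagrangian (hφ : φ ∈ IsManifold.maximalAtlas (𝓡 n) ∞ M)
    {p : EuclideanSpace ℝ (Fin n) × EuclideanSpace ℝ (Fin n)} (hx : p.1 ∈ φ.target)
    (hy : p.2 ≠ 0) : ContDiffAt ℝ ∞ (F.lagrangian φ) p :=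
  (contDiffAt_inChart F hφ hx hy).pow 2

theorem fundamentalTensor_inChart (hφ : φ ∈ IsManifold.maximalAtlas (𝓡 n) ∞ M)
    {p : EuclideanSpace ℝ (Fin n) × EuclideanSpace ℝ (Fin n)} (hx : p.1 ∈ φ.target)
    (hy : p.2 ≠ 0) (u w : EuclideanSpace ℝ (Fin n)) :
    fundamentalTensor (F.inChart φ p.1) p.2 u w =
      1 / 2 * fderiv ℝ (fderiv ℝ (F.lagrangian φ)) p (0, u) (0, w) := by
  rw [fundamentalTensor, ← lineDeriv_snd_lineDeriv_snd (x := p.1) (y := p.2)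
    ((contDiffAt_lagrangian F hφ hx hy).of_le ENat.LEInfty.out)]
  rfl

theorem vertical_hessian_pos (hφ : φ ∈ IsManifold.maximalAtlas (𝓡 n) ∞ M)
    {p : EuclideanSpace ℝ (Fin n) × EuclideanSpace ℝ (Fin n)} (hx : p.1 ∈ φ.target)
    (hy : p.2 ≠ 0) {u : EuclideanSpace ℝ (Fin n)} (hu : u ≠ 0) :
    0 < fderiv ℝ (fderiv ℝ (F.lagrangian φ)) p (0, u) (0, u) := by
  have := fundamentalTensor_inChart_pos F hφ hx hy hu
  rw [fundamentalTensor_inChart F hφ hx hy] at this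
  linarith

theorem vertical_hessian_symm (hφ : φ ∈ IsManifold.maximalAtlas (𝓡 n) ∞ M)
    {p : EuclideanSpace ℝ (Fin n) × EuclideanSpace ℝ (Fin n)} (hx : p.1 ∈ φ.target)
    (hy : p.2 ≠ 0) (v w : EuclideanSpace ℝ (Fin n) × EuclideanSpace ℝ (Fin n)) :
    fderiv ℝ (fderiv ℝ (F.lagrangian φ)) p v w = fderiv ℝ (fderiv ℝ (F.lagrangian φ)) p w v :=
  ((contDiffAt_lagrangian F hφ hx hy).isSymmSndFDerivAt (by simpa using ENat.LEInfty.out)).eq _ _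

theorem map_eq_sum_single {V : Type*} [AddCommGroup V] [Module ℝ V]
    (A : EuclideanSpace ℝ (Fin n) →ₗ[ℝ] V) (u : EuclideanSpace ℝ (Fin n)) :
    A u = ∑ i, u i • A (EuclideanSpace.single i 1) := by
  conv_lhs => rw [← (EuclideanSpace.basisFun (Fin n) ℝ).sum_repr u]
  simp

/-- The accelerations with vanishing Euler–Lagrange expression are unique, because the fundamental
tensor is nondegenerate. -/
theorem eq_of_eulerLagrange_eq (hφ : φ ∈ IsManifold.maximalAtlas (𝓡 n) ∞ M)
    {p : EuclideanSpace ℝ (Fin n) × EuclideanSpace ℝ (Fin n)} (hx : p.1 ∈ φ.target)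
    (hy : p.2 ≠ 0) {a a' : EuclideanSpace ℝ (Fin n)}
    (h : ∀ w, eulerLagrange (F.lagrangian φ) p a w = eulerLagrange (F.lagrangian φ) p a' w) :
    a = a' := by
  by_contra hne
  have h1 := vertical_hessian_pos F hφ hx hy (sub_ne_zero.2 hne)
  have h2 := h (a - a')
  unfold eulerLagrange at h2
  have h3 : ((0 : EuclideanSpace ℝ (Fin n)), a - a') = (p.2, a) - (p.2, a') := by simp
  nth_rw 1 [h3] at h1
  rw [map_sub, _root_.sub_apply] at h1
  linarith

/-- The geodesic acceleration solves the Euler–Lagrange equation. -/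
theorem eulerLagrange_accel (hφ : φ ∈ IsManifold.maximalAtlas (𝓡 n) ∞ M)
    {p : EuclideanSpace ℝ (Fin n) × EuclideanSpace ℝ (Fin n)} (hx : p.1 ∈ φ.target)
    (hy : p.2 ≠ 0) (w : EuclideanSpace ℝ (Fin n)) :
    eulerLagrange (F.lagrangian φ) p (F.accel φ p) w = 0 := by
  set L := F.lagrangian φ with hL
  set H := fderiv ℝ (fderiv ℝ L) p with hH
  have hsm : ContDiffAt ℝ 2 L (p.1, p.2) :=
    (contDiffAt_lagrangian F hφ hx hy).of_le ENat.LEInfty.out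
  set A := F.gMatrix φ p.1 p.2 with hA
  have hAij : ∀ i j, A i j = 1 / 2 * H (0, EuclideanSpace.single i 1)
      (0, EuclideanSpace.single j 1) := fun i j => fundamentalTensor_inChart F hφ hx hy _ _
  -- The matrix `A` represents half of the vertical Hessian.
  have hAu : ∀ (u : EuclideanSpace ℝ (Fin n)) (l : Fin n),
      A.mulVec u.ofLp l = 1 / 2 * H (0, u) (0, EuclideanSpace.single l 1) := by
    intro u l
    have := map_eq_sum_single ((H (0, EuclideanSpace.single l 1)).comp
      (ContinuousLinearMap.inr ℝ _ _)).toLinearMap u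
    simp only [ContinuousLinearMap.coe_coe, ContinuousLinearMap.comp_apply,
      ContinuousLinearMap.inr_apply, smul_eq_mul] at this
    rw [vertical_hessian_symm F hφ hx hy, this, Matrix.mulVec, dotProduct, Finset.mul_sum]
    exact Finset.sum_congr rfl fun i _ => by rw [hAij]; ring
  have hunit : IsUnit A := by
    rw [← Matrix.mulVec_injective_iff_isUnit]
    refine (injective_iff_map_eq_zero (Matrix.mulVecLin A)).2 fun u hu => ?_
    by_contra hne
    have hne' : WithLp.toLp 2 u ≠ (0 : EuclideanSpace ℝ (Fin n)) := fun h => hne (by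
      simpa using congrArg WithLp.ofLp h)
    have h1 := vertical_hessian_pos F hφ hx hy hne'
    have h2 := map_eq_sum_single ((H (0, WithLp.toLp 2 u)).comp
      (ContinuousLinearMap.inr ℝ _ _)).toLinearMap (WithLp.toLp 2 u)
    simp only [ContinuousLinearMap.coe_coe, ContinuousLinearMap.comp_apply,
      ContinuousLinearMap.inr_apply, smul_eq_mul] at h2
    rw [← hL, ← hH, h2] at h1
    refine h1.ne' (Finset.sum_eq_zero fun l _ => ?_)
    have h3 := hAu (WithLp.toLp 2 u) l
    have h4 : A.mulVec u l = 0 := congrFun hu l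
    rw [show A.mulVec (WithLp.toLp 2 u : EuclideanSpace ℝ (Fin n)).ofLp l = 0 from h4] at h3
    rw [show (H (0, WithLp.toLp 2 u)) (0, EuclideanSpace.single l 1) = 0 by linarith, mul_zero]
  set b : Fin n → ℝ := fun l => H (p.2, 0) (0, EuclideanSpace.single l 1)
    - fderiv ℝ L p (EuclideanSpace.single l 1, 0) with hb
  have hspray : ∀ i, F.spray φ p.1 p.2 i = 1 / 4 * A⁻¹.mulVec b i := by
    intro i
    unfold FinslerMetric.spray
    congr 1
    refine Finset.sum_congr rfl fun l _ => ?_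
    congr 1
    have e1 := lineDeriv_fst (x := p.1) (y := p.2) (hsm.differentiableAt (by simp))
      (EuclideanSpace.single l 1)
    have e2 := fun k => lineDeriv_fst_lineDeriv_snd (x := p.1) (y := p.2) hsm
      (EuclideanSpace.single k 1) (EuclideanSpace.single l 1)
    have e3 := map_eq_sum_single ((H.flip (0, EuclideanSpace.single l 1)).comp
      (ContinuousLinearMap.inl ℝ _ _)).toLinearMap p.2
    simp only [ContinuousLinearMap.coe_coe, ContinuousLinearMap.comp_apply,
      ContinuousLinearMap.inl_apply, smul_eq_mul, ContinuousLinearMap.flip_apply] at e3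
    simp only [hb]
    rw [e3]
    congr 1
    refine Finset.sum_congr rfl fun k _ => ?_
    rw [mul_comm]
    congr 1
    exact e2 k
  have hsolve : ∀ l, A.mulVec (F.accel φ p).ofLp l = -(1 / 2 * b l) := by
    intro l
    have e : (F.accel φ p).ofLp = (-(1 / 2) : ℝ) • A⁻¹.mulVec b := by
      ext i
      rw [accel_apply, hspray, Pi.smul_apply, smul_eq_mul]
      ring
    rw [e, Matrix.mulVec_smul, Matrix.mulVec_mulVec,
      Matrix.mul_nonsing_inv _ ((Matrix.isUnit_iff_isUnit_det A).1 hunit), Matrix.one_mulVec,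
      Pi.smul_apply, smul_eq_mul]
    ring
  have hbasis : ∀ l, eulerLagrange L p (F.accel φ p) (EuclideanSpace.single l 1) = 0 := by
    intro l
    have h1 := hsolve l
    rw [hAu] at h1
    have h2 : (p.2, F.accel φ p) = (p.2, (0 : EuclideanSpace ℝ (Fin n))) + (0, F.accel φ p) := by
      simp
    rw [eulerLagrange, ← hH, h2, map_add, _root_.add_apply]
    simp only [hb] at h1
    linarith
  have h5 := map_eq_sum_single ((H (p.2, F.accel φ p)).comp (ContinuousLinearMap.inr ℝ _ _) -
    (fderiv ℝ L p).comp (ContinuousLinearMap.inl ℝ _ _)).toLinearMap w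
  simp only [ContinuousLinearMap.coe_coe, ContinuousLinearMap.comp_apply, _root_.sub_apply,
    ContinuousLinearMap.inl_apply, ContinuousLinearMap.inr_apply, smul_eq_mul] at h5
  rw [eulerLagrange, ← hH, h5]
  exact Finset.sum_eq_zero fun l _ => by
    have := hbasis l
    rw [eulerLagrange] at this
    rw [this, mul_zero]

theorem contDiffAt_accel (hφ : φ ∈ IsManifold.maximalAtlas (𝓡 n) ∞ M)
    {p : EuclideanSpace ℝ (Fin n) × EuclideanSpace ℝ (Fin n)} (hx : p.1 ∈ φ.target)
    (hy : p.2 ≠ 0) : ContDiffAt ℝ 1 (F.accel φ) p := by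
  let E := EuclideanSpace ℝ (Fin n)
  set L := F.lagrangian φ with hL
  -- The vertical Hessian as a map into the dual, and the inhomogeneous part of the equation.
  set B : E × E → E →L[ℝ] E →L[ℝ] ℝ := fun q =>
    (((ContinuousLinearMap.compL ℝ E (E × E) ℝ).flip (ContinuousLinearMap.inr ℝ E E)).comp
      (fderiv ℝ (fderiv ℝ L) q)).comp (ContinuousLinearMap.inr ℝ E E) with hB
  set c : E × E → E →L[ℝ] ℝ := fun q =>
    (fderiv ℝ L q).comp (ContinuousLinearMap.inl ℝ E E) -
      (fderiv ℝ (fderiv ℝ L) q (q.2, 0)).comp (ContinuousLinearMap.inr ℝ E E) with hc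
  have hBapp : ∀ q u w, B q u w = fderiv ℝ (fderiv ℝ L) q (0, u) (0, w) := fun q u w => by
    simp [hB]
  have hs := contDiffAt_lagrangian F hφ hx hy
  have hs1 : ContDiffAt ℝ 2 (fderiv ℝ L) p := hs.fderiv_right (by
    rw [show (2 + 1 : WithTop ℕ∞) = 3 by norm_num]; exact ENat.LEInfty.out)
  have hs2 : ContDiffAt ℝ 1 (fderiv ℝ (fderiv ℝ L)) p := hs1.fderiv_right (by norm_num)
  have hBs : ContDiffAt ℝ 1 B p := (contDiffAt_const.clm_comp hs2).clm_comp contDiffAt_const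
  have hcs : ContDiffAt ℝ 1 c p :=
    ((hs1.of_le (by norm_num)).clm_comp contDiffAt_const).sub
      ((hs2.clm_apply (contDiffAt_snd.prodMk contDiffAt_const)).clm_comp contDiffAt_const)
  have hmem : ∀ᶠ q in 𝓝 p, q.1 ∈ φ.target ∧ q.2 ≠ 0 :=
    (φ.open_target.prod isOpen_compl_singleton).mem_nhds ⟨hx, hy⟩
  have hequiv : ∀ q : E × E, q.1 ∈ φ.target → q.2 ≠ 0 →
      ∃ e : E ≃L[ℝ] (E →L[ℝ] ℝ), (e : E →L[ℝ] E →L[ℝ] ℝ) = B q := by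
    intro q hqx hqy
    have hinj : Function.Injective (B q).toLinearMap := by
      refine (injective_iff_map_eq_zero _).2 fun u hu => ?_
      by_contra hne
      have h1 := vertical_hessian_pos F hφ hqx hqy hne
      rw [← hL, ← hBapp, show B q u = 0 from hu] at h1
      simp at h1
    have hrank : Module.finrank ℝ E = Module.finrank ℝ (E →L[ℝ] ℝ) := by
      rw [← (LinearMap.toContinuousLinearMap (𝕜 := ℝ) (E := E) (F' := ℝ)).finrank_eq]
      exact (Subspace.dual_finrank_eq).symm
    refine
      ⟨(LinearEquiv.ofInjectiveOfFinrankEq (B q).toLinearMap hinj hrank).toContinuousLinearEquiv,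
      ?_⟩
    ext u w
    rfl
  have hsol : ∀ q : E × E, q.1 ∈ φ.target → q.2 ≠ 0 →
      F.accel φ q = ContinuousLinearMap.inverse (B q) (c q) := by
    intro q hqx hqy
    obtain ⟨e, he⟩ := hequiv q hqx hqy
    rw [← he, ContinuousLinearMap.inverse_equiv]
    change _ = e.symm (c q)
    rw [ContinuousLinearEquiv.eq_symm_apply]
    ext w
    have h1 := eulerLagrange_accel F hφ hqx hqy w
    have h2 : (q.2, F.accel φ q) = (q.2, (0 : E)) + (0, F.accel φ q) := by simp
    rw [eulerLagrange, h2, map_add, _root_.add_apply] at h1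
    rw [show e (F.accel φ q) = B q (F.accel φ q) by rw [← he]; rfl, hBapp]
    simp only [hc, _root_.sub_apply, ContinuousLinearMap.comp_apply,
      ContinuousLinearMap.inl_apply, ContinuousLinearMap.inr_apply]
    linarith
  obtain ⟨e, he⟩ := hequiv p hx hy
  have hinv : ContDiffAt ℝ 1 (fun q => ContinuousLinearMap.inverse (B q)) p := by
    refine ContDiffAt.comp p (g := ContinuousLinearMap.inverse) ?_ hBs
    rw [← he]
    exact contDiffAt_map_inverse e
  refine (hinv.clm_apply hcs).congr_of_eventuallyEq ?_
  filter_upwards [hmem] with q hq using hsol q hq.1 hq.2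

/-- The geodesic acceleration transforms like the second derivative of a curve. -/
theorem accel_trans {ψ : OpenPartialHomeomorph M (EuclideanSpace ℝ (Fin n))}
    (hφ : φ ∈ IsManifold.maximalAtlas (𝓡 n) ∞ M) (hψ : ψ ∈ IsManifold.maximalAtlas (𝓡 n) ∞ M)
    {p : EuclideanSpace ℝ (Fin n) × EuclideanSpace ℝ (Fin n)} (hx : p.1 ∈ φ.target)
    (hx' : φ.symm p.1 ∈ ψ.source) (hy : p.2 ≠ 0) :
    F.accel ψ (ψ (φ.symm p.1), fderiv ℝ (ψ ∘ φ.symm) p.1 p.2) =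
      fderiv ℝ (fderiv ℝ (ψ ∘ φ.symm)) p.1 p.2 p.2 +
        fderiv ℝ (ψ ∘ φ.symm) p.1 (F.accel φ p) := by
  set T := ψ ∘ φ.symm with hTdef
  have hU : ∀ᶠ q in 𝓝 p, q.1 ∈ φ.target ∧ φ.symm q.1 ∈ ψ.source :=
    continuousAt_fst.eventually ((φ.open_target.eventually_mem hx).and
      ((φ.continuousAt_symm hx).eventually (ψ.open_source.eventually_mem hx')))
  have hT : ContDiffAt ℝ ∞ T p.1 :=
    (((contMDiffOn_of_mem_maximalAtlas hψ).contMDiffAt (ψ.open_source.mem_nhds hx')).comp p.1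
      ((contMDiffOn_symm_of_mem_maximalAtlas hφ).contMDiffAt
        (φ.open_target.mem_nhds hx))).contDiffAt
  have hTinv : (φ ∘ ψ.symm) ∘ T =ᶠ[𝓝 p.1] id := by
    filter_upwards [φ.open_target.mem_nhds hx,
      (φ.continuousAt_symm hx).preimage_mem_nhds (ψ.open_source.mem_nhds hx')] with z hz hz'
    simp [hTdef, ψ.left_inv hz', φ.right_inv hz]
  have hS : DifferentiableAt ℝ (φ ∘ ψ.symm) (T p.1) := by
    have hx2 : T p.1 ∈ ψ.target := ψ.map_source hx'
    have hx3 : ψ.symm (T p.1) ∈ φ.source := by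
      simp [hTdef, ψ.left_inv hx', φ.map_target hx]
    exact ((((contMDiffOn_of_mem_maximalAtlas hφ).contMDiffAt (φ.open_source.mem_nhds hx3)).comp
      (T p.1) ((contMDiffOn_symm_of_mem_maximalAtlas hψ).contMDiffAt
        (ψ.open_target.mem_nhds hx2))).contDiffAt).differentiableAt (by simp)
  have hTd : DifferentiableAt ℝ T p.1 := hT.differentiableAt (by simp)
  have hcomp : (fderiv ℝ (φ ∘ ψ.symm) (T p.1)).comp (fderiv ℝ T p.1) =
      ContinuousLinearMap.id ℝ _ := by
    rw [← fderiv_comp p.1 hS hTd, hTinv.fderiv_eq, fderiv_id]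
  have hinj : Function.Injective (fderiv ℝ T p.1) := fun u v huv => by
    have h1 := DFunLike.congr_fun hcomp u
    have h2 := DFunLike.congr_fun hcomp v
    simp only [ContinuousLinearMap.comp_apply, ContinuousLinearMap.id_apply] at h1 h2
    rw [← h1, ← h2, huv]
  have hsurj : Function.Surjective (fderiv ℝ T p.1) :=
    (LinearMap.injective_iff_surjective (f := (fderiv ℝ T p.1).toLinearMap)).1 hinj
  have hy' : fderiv ℝ T p.1 p.2 ≠ 0 := fun h => hy (hinj (h.trans (map_zero _).symm))
  have hL : F.lagrangian φ =ᶠ[𝓝 p] fun q => F.lagrangian ψ (T q.1, fderiv ℝ T q.1 q.2) := by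
    filter_upwards [hU] with q hq
    unfold FinslerMetric.lagrangian
    rw [inChart_trans F hφ hψ hq.1 hq.2]
    rfl
  refine eq_of_eulerLagrange_eq F hψ (p := (T p.1, fderiv ℝ T p.1 p.2)) (ψ.map_source hx') hy'
    fun w => ?_
  obtain ⟨v, rfl⟩ := hsurj w
  have h1 := eulerLagrange_comp (hT.of_le ENat.LEInfty.out)
    ((contDiffAt_lagrangian F hφ hx hy).of_le ENat.LEInfty.out)
    ((contDiffAt_lagrangian F hψ (p := (T p.1, fderiv ℝ T p.1 p.2)) (ψ.map_source hx') hy').of_le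
      ENat.LEInfty.out) hL (F.accel φ p) v
  rw [eulerLagrange_accel F hφ hx hy] at h1
  exact (eulerLagrange_accel F hψ (p := (T p.1, fderiv ℝ T p.1 p.2)) (ψ.map_source hx') hy' _).trans
    h1

theorem lineDeriv_smul_point {V : Type*} [AddCommGroup V] [Module ℝ V] {g : V → ℝ} {s c : ℝ}
    (hs : s ≠ 0) (hg : ∀ v, g (s • v) = c * g v) (v w : V) :
    lineDeriv ℝ g (s • v) w = c / s * lineDeriv ℝ g v w := by
  have h1 : (fun t : ℝ => g (s • v + t • w)) = fun t => c * (fun r => g (v + r • w)) (s⁻¹ * t) := by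
    ext t
    rw [← hg, smul_add, smul_smul, mul_inv_cancel_left₀ hs]
  rw [lineDeriv, h1, deriv_const_mul_field,
    deriv_comp_mul_left (f := fun r : ℝ => g (v + r • w)), lineDeriv]
  simp only [mul_zero, smul_eq_mul]
  ring

/-- The spray coefficients are positively homogeneous of degree two. -/
theorem spray_smul (x y : EuclideanSpace ℝ (Fin n)) {s : ℝ} (hs : 0 < s) (i : Fin n) :
    F.spray φ x (s • y) i = s ^ 2 * F.spray φ x y i := by
  have hN : ∀ x' v, F.inChart φ x' (s • v) ^ 2 = s ^ 2 * F.inChart φ x' v ^ 2 := fun x' v => by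
    rw [inChart_smul F _ _ hs.le, mul_pow]
  have h1 : ∀ x' v w, lineDeriv ℝ (fun y' => F.inChart φ x' y' ^ 2) (s • v) w =
      s * lineDeriv ℝ (fun y' => F.inChart φ x' y' ^ 2) v w := fun x' v w => by
    rw [lineDeriv_smul_point hs.ne' (hN x')]
    congr 1
    field_simp
  have hg : F.gMatrix φ x (s • y) = F.gMatrix φ x y := by
    ext j k
    simp only [FinslerMetric.gMatrix, Matrix.of_apply, fundamentalTensor]
    rw [lineDeriv_smul_point hs.ne' (fun v => h1 x v _), div_self hs.ne', one_mul]
  have hconst : ∀ (a : ℝ) (g : EuclideanSpace ℝ (Fin n) → ℝ) (v w : EuclideanSpace ℝ (Fin n)),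
      lineDeriv ℝ (fun x' => a * g x') v w = a * lineDeriv ℝ g v w := fun a g v w => by
    rw [lineDeriv, deriv_const_mul_field, lineDeriv]
  unfold FinslerMetric.spray
  simp only [hg, h1, hN, hconst, PiLp.smul_apply, smul_eq_mul]
  rw [mul_left_comm]
  congr 1
  rw [Finset.mul_sum]
  refine Finset.sum_congr rfl fun l _ => ?_
  rw [mul_left_comm]
  congr 1
  rw [mul_sub, Finset.mul_sum]
  congr 1
  refine Finset.sum_congr rfl fun k _ => ?_
  ring

end Spray

/-! ### Geodesics in local coordinates -/

section Geodesics

variable {n : ℕ} {M : Type*} [TopologicalSpace M] [ChartedSpace (EuclideanSpace ℝ (Fin n)) M]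
  {φ : OpenPartialHomeomorph M (EuclideanSpace ℝ (Fin n))}

theorem hasDerivAt_coord {f : ℝ → EuclideanSpace ℝ (Fin n)} {f' : EuclideanSpace ℝ (Fin n)} {t : ℝ}
    (h : HasDerivAt f f' t) (i : Fin n) : HasDerivAt (fun s => f s i) (f' i) t :=
  (EuclideanSpace.proj (𝕜 := ℝ) i).hasFDerivAt.comp_hasDerivAt t h

theorem contDiffAt_chart_comp (hφ : φ ∈ IsManifold.maximalAtlas (𝓡 n) ∞ M) {γ : ℝ → M} {t : ℝ}
    (hγ : ContMDiffAt 𝓘(ℝ, ℝ) (𝓡 n) 2 γ t) (ht : γ t ∈ φ.source) : ContDiffAt ℝ 2 (φ ∘ γ) t :=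
  ((((contMDiffOn_of_mem_maximalAtlas hφ).contMDiffAt (φ.open_source.mem_nhds ht)).of_le
    ENat.LEInfty.out).comp t hγ).contDiffAt

theorem hasDerivAt_deriv_of_contDiffAt {E : Type*} [NormedAddCommGroup E] [NormedSpace ℝ E]
    {ξ : ℝ → E} {t : ℝ} (h : ContDiffAt ℝ 2 ξ t) : HasDerivAt (deriv ξ) (deriv (deriv ξ) t) t := by
  have : ContDiffAt ℝ 1 (fun s => fderiv ℝ ξ s 1) t :=
    (h.fderiv_right (m := 1) (by norm_num)).clm_apply contDiffAt_const
  exact (this.differentiableAt (by simp)).hasDerivAt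

theorem hasDerivAt_fderiv_apply {E : Type*} [NormedAddCommGroup E] [NormedSpace ℝ E] {T : E → E}
    {ξ η : ℝ → E} {v a : E} {t : ℝ} (hT : ContDiffAt ℝ 2 T (ξ t)) (hξ : HasDerivAt ξ v t)
    (hη : HasDerivAt η a t) : HasDerivAt (fun s => fderiv ℝ T (ξ s) (η s))
      (fderiv ℝ (fderiv ℝ T) (ξ t) v (η t) + fderiv ℝ T (ξ t) a) t := by
  have h1 : HasFDerivAt (fderiv ℝ T) (fderiv ℝ (fderiv ℝ T) (ξ t)) (ξ t) :=
    ((hT.fderiv_right (m := 1) (by norm_num)).differentiableAt (by simp)).hasFDerivAt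
  exact (h1.comp_hasDerivAt t hξ).clm_apply hη

variable [IsManifold (𝓡 n) ∞ M] {F : FinslerMetric n M}

/-- A twice differentiable curve in a chart satisfies the geodesic equation in coordinates if and
only if its acceleration is the geodesic one. -/
theorem geodesic_equation_iff {ξ ξ₁ : ℝ → EuclideanSpace ℝ (Fin n)}
    {a : EuclideanSpace ℝ (Fin n)} {t : ℝ} (h1 : ∀ᶠ s in 𝓝 t, HasDerivAt ξ (ξ₁ s) s)
    (h2 : HasDerivAt ξ₁ a t) :
    (∀ i : Fin n, deriv (deriv fun s => ξ s i) t + 2 * F.spray φ (ξ t) (deriv ξ t) i = 0) ↔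
      a = F.accel φ (ξ t, ξ₁ t) := by
  have e1 : deriv ξ t = ξ₁ t := h1.self_of_nhds.deriv
  have e2 : ∀ i, deriv (deriv fun s => ξ s i) t = a i := by
    intro i
    have : deriv (fun s => ξ s i) =ᶠ[𝓝 t] fun s => ξ₁ s i := by
      filter_upwards [h1] with s hs using (hasDerivAt_coord hs i).deriv
    rw [this.deriv_eq, (hasDerivAt_coord h2 i).deriv]
  simp only [e1, e2]
  constructor
  · intro h
    ext i
    rw [accel_apply]
    linarith [h i]
  · rintro rfl i
    rw [accel_apply]
    ring

/-- A geodesic, read in a chart around its initial point, solves the geodesic equation. -/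
theorem FinslerMetric.IsGeodesicOn.exists_isSolutionIn {γ : ℝ → M} {δ : ℝ} (hδ : 0 < δ)
    (hγ : F.IsGeodesicOn γ (Ioo (-δ) δ)) (hφ : φ ∈ IsManifold.maximalAtlas (𝓡 n) ∞ M)
    (h0 : γ 0 ∈ φ.source) :
    ∃ τ > 0, IsSolutionIn (F.accel φ) univ τ (fun t => (φ (γ t), deriv (φ ∘ γ) t)) := by
  have hγat : ∀ t ∈ Ioo (-δ) δ, ContMDiffAt 𝓘(ℝ, ℝ) (𝓡 n) 2 γ t := fun t ht =>
    hγ.1.contMDiffAt (isOpen_Ioo.mem_nhds ht)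
  have h0δ : (0 : ℝ) ∈ Ioo (-δ) δ := ⟨by linarith, hδ⟩
  have hev : ∀ᶠ t in 𝓝 (0 : ℝ), t ∈ Ioo (-δ) δ ∧ γ t ∈ φ.source :=
    (isOpen_Ioo.eventually_mem h0δ).and
      ((hγat 0 h0δ).continuousAt.eventually (φ.open_source.eventually_mem h0))
  obtain ⟨τ, hτ, hball⟩ := Metric.eventually_nhds_iff_ball.1 hev
  refine ⟨τ, hτ, fun t ht => ⟨mem_univ _, ?_⟩⟩
  rw [show Ioo (-τ) τ = Metric.ball 0 τ by simp [Real.ball_eq_Ioo]] at ht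
  have hsm : ∀ s ∈ Metric.ball (0 : ℝ) τ, ContDiffAt ℝ 2 (φ ∘ γ) s := fun s hs =>
    contDiffAt_chart_comp hφ (hγat s (hball s hs).1) (hball s hs).2
  have h1 : ∀ s ∈ Metric.ball (0 : ℝ) τ, HasDerivAt (φ ∘ γ) (deriv (φ ∘ γ) s) s := fun s hs =>
    ((hsm s hs).differentiableAt (by simp)).hasDerivAt
  have h2 := hasDerivAt_deriv_of_contDiffAt (hsm t ht)
  have h3 := (geodesic_equation_iff (F := F) (φ := φ)
    (by filter_upwards [Metric.isOpen_ball.mem_nhds ht] with s hs using h1 s hs) h2).1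
    (hγ.2 φ hφ t (hball t ht).1 (hball t ht).2)
  rw [h3] at h2
  exact (h1 t ht).prodMk h2

/-- A solution of the geodesic equation in one chart, with nonvanishing velocity, is a geodesic. -/
theorem IsSolutionIn.isGeodesicOn {α : ℝ → EuclideanSpace ℝ (Fin n) × EuclideanSpace ℝ (Fin n)}
    {τ : ℝ} (hφ : φ ∈ IsManifold.maximalAtlas (𝓡 n) ∞ M)
    (hα : IsSolutionIn (F.accel φ) (φ.target ×ˢ {0}ᶜ) τ α) :
    F.IsGeodesicOn (fun t => φ.symm (α t).1) (Ioo (-τ) τ) := by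
  have hmem : ∀ t ∈ Ioo (-τ) τ, (α t).1 ∈ φ.target ∧ (α t).2 ≠ 0 := fun t ht => (hα t ht).1
  have hacc : ∀ t ∈ Ioo (-τ) τ, ContinuousAt (fun s => F.accel φ (α s)) t := fun t ht =>
    (contDiffAt_accel F hφ (hmem t ht).1 (hmem t ht).2).continuousAt.comp (hα t ht).2.continuousAt
  have hC1 : ContDiffOn ℝ 1 (fun t => (α t).2) (Ioo (-τ) τ) := by
    have := (contDiffOn_succ_iff_deriv_of_isOpen (𝕜 := ℝ) (n := 0) (f := fun t => (α t).2)
      (isOpen_Ioo (a := -τ) (b := τ))).2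
      ⟨fun t ht => (hα.hasDerivAt_snd ht).differentiableAt.differentiableWithinAt, by simp, ?_⟩
    · simpa using this
    · refine contDiffOn_zero.2 (ContinuousOn.congr (f := fun s => F.accel φ (α s))
        (fun t ht => (hacc t ht).continuousWithinAt) fun t ht => (hα.hasDerivAt_snd ht).deriv)
  have hC2 : ContDiffOn ℝ 2 (fun t => (α t).1) (Ioo (-τ) τ) := by
    have := (contDiffOn_succ_iff_deriv_of_isOpen (𝕜 := ℝ) (n := 1) (f := fun t => (α t).1)
      (isOpen_Ioo (a := -τ) (b := τ))).2
      ⟨fun t ht => (hα.hasDerivAt_fst ht).differentiableAt.differentiableWithinAt, by simp,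
        hC1.congr fun t ht => (hα.hasDerivAt_fst ht).deriv⟩
    rwa [show (1 + 1 : WithTop ℕ∞) = 2 by norm_num] at this
  refine ⟨((contMDiffOn_symm_of_mem_maximalAtlas hφ).of_le ENat.LEInfty.out).comp
    hC2.contMDiffOn fun t ht => (hmem t ht).1, ?_⟩
  intro ψ hψ t ht hts
  let T := ψ ∘ φ.symm
  have hTs : ContDiffAt ℝ 2 T (α t).1 :=
    ((((contMDiffOn_of_mem_maximalAtlas hψ).contMDiffAt (ψ.open_source.mem_nhds hts)).comp (α t).1
      ((contMDiffOn_symm_of_mem_maximalAtlas hφ).contMDiffAt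
        (φ.open_target.mem_nhds (hmem t ht).1))).contDiffAt).of_le ENat.LEInfty.out
  have hev : ∀ᶠ s in 𝓝 t, ContDiffAt ℝ 2 T (α s).1 :=
    (hα t ht).2.continuousAt.fst.eventually (hTs.eventually (by simp))
  have h1 : ∀ᶠ s in 𝓝 t, HasDerivAt (fun s => T (α s).1) (fderiv ℝ T (α s).1 (α s).2) s := by
    filter_upwards [hev, isOpen_Ioo.mem_nhds ht] with s hs hsI
    exact (hs.differentiableAt (by simp)).hasFDerivAt.comp_hasDerivAt s (hα.hasDerivAt_fst hsI)
  have h2 : HasDerivAt (fun s => fderiv ℝ T (α s).1 (α s).2)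
      (fderiv ℝ (fderiv ℝ T) (α t).1 (α t).2 (α t).2 +
        fderiv ℝ T (α t).1 (F.accel φ (α t))) t :=
    hasDerivAt_fderiv_apply hTs (hα.hasDerivAt_fst ht) (hα.hasDerivAt_snd ht)
  have h4 := accel_trans F hφ hψ (p := α t) (hmem t ht).1 hts (hmem t ht).2
  have h5 := (geodesic_equation_iff (F := F) (φ := ψ) (ξ := fun s => T (α s).1)
    (ξ₁ := fun s => fderiv ℝ T (α s).1 (α s).2) h1 h2).2 h4.symm
  exact fun i => h5 i

theorem FinslerMetric.IsGeodesicOn.mono {γ : ℝ → M} {J J' : Set ℝ} (h : F.IsGeodesicOn γ J)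
    (hJ : J' ⊆ J) : F.IsGeodesicOn γ J' :=
  ⟨h.1.mono hJ, fun φ hφ t ht => h.2 φ hφ t (hJ ht)⟩

theorem deriv_comp_affine {E : Type*} [NormedAddCommGroup E] [NormedSpace ℝ E] (g : ℝ → E)
    (t₀ s t : ℝ) : deriv (fun u => g (t₀ + s * u)) t = s • deriv g (t₀ + s * t) := by
  rw [deriv_comp_mul_left (f := fun u => g (t₀ + u)), deriv_comp_const_add]

/-- Affine reparametrizations of geodesics are geodesics. -/
theorem FinslerMetric.IsGeodesicOn.comp_affine {γ : ℝ → M} {J : Set ℝ} (h : F.IsGeodesicOn γ J)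
    (t₀ : ℝ) {s : ℝ} (hs : 0 < s) :
    F.IsGeodesicOn (fun t => γ (t₀ + s * t)) {t | t₀ + s * t ∈ J} := by
  refine ⟨h.1.comp (ContDiff.contMDiff (by fun_prop)).contMDiffOn fun t ht => ht, ?_⟩
  intro φ hφ t ht hts i
  have h1 := h.2 φ hφ _ ht hts i
  have h2 : deriv (φ ∘ fun t => γ (t₀ + s * t)) t = s • deriv (φ ∘ γ) (t₀ + s * t) :=
    deriv_comp_affine (φ ∘ γ) t₀ s t
  have h3 : (deriv fun u => φ (γ (t₀ + s * u)) i) =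
      fun u => s * deriv (fun v => φ (γ v) i) (t₀ + s * u) :=
    funext fun u => deriv_comp_affine (fun v => φ (γ v) i) t₀ s u
  have h4 : deriv (deriv fun u => φ (γ (t₀ + s * u)) i) t =
      s * (s * deriv (deriv fun v => φ (γ v) i) (t₀ + s * t)) := by
    rw [h3, deriv_const_mul_field, deriv_comp_affine (deriv fun v => φ (γ v) i)]
    rfl
  rw [h2, h4, spray_smul F _ _ hs]
  linear_combination s ^ 2 * h1

theorem velocity_comp_affine {γ : ℝ → M} (t₀ : ℝ) {s t : ℝ} (hs : 0 < s)
    (hγ : MDifferentiableAt 𝓘(ℝ, ℝ) (𝓡 n) γ (t₀ + s * t)) :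
    F.toFun (velocity (fun u => γ (t₀ + s * u)) t) = s * F.toFun (velocity γ (t₀ + s * t)) := by
  have hφ := IsManifold.chart_mem_maximalAtlas (I := 𝓡 n) (n := ∞) (γ (t₀ + s * t))
  set φ := chartAt (EuclideanSpace ℝ (Fin n)) (γ (t₀ + s * t))
  have hsrc : γ (t₀ + s * t) ∈ φ.source := mem_chart_source _ _
  have haff : MDifferentiableAt 𝓘(ℝ, ℝ) 𝓘(ℝ, ℝ) (fun u : ℝ => t₀ + s * u) t :=
    DifferentiableAt.mdifferentiableAt (by fun_prop)
  rw [← inChart_deriv F hφ (γ := fun u => γ (t₀ + s * u)) (t := t) (hγ.comp t haff) hsrc,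
    ← inChart_deriv F hφ hγ hsrc, ← inChart_smul F _ _ hs.le]
  congr 1
  exact deriv_comp_affine (φ ∘ γ) t₀ s t

/-- Lower bounds for second differences along unit speed geodesics give bounds along all geodesics,
scaled by the square of the speed. -/
theorem eventually_le_secondDiff_of_isGeodesicOn {f : M → ℝ} {K : Set M} {lam : ℝ}
    (hlam : ∀ (c : ℝ → M) (δ : ℝ), 0 < δ → F.IsGeodesicOn c (Ioo (-δ) δ) → c 0 ∈ K →
      F.toFun (velocity c 0) = 1 → (lam : EReal) ≤ lowerSecondDeriv f c)
    {γ : ℝ → M} {τ : ℝ} (hγ : F.IsGeodesicOn γ (Ioo (-τ) τ)) {t : ℝ} (ht : t ∈ Ioo (-τ) τ)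
    (hK : γ t ∈ K) (hpos : 0 < F.toFun (velocity γ t)) {μ : ℝ}
    (hμ : μ < lam * F.toFun (velocity γ t) ^ 2) :
    ∀ᶠ r in 𝓝 (0 : ℝ), μ * r ^ 2 ≤ f (γ (t + r)) + f (γ (t - r)) - 2 * f (γ t) := by
  set s := F.toFun (velocity γ t) with hs
  set c : ℝ → M := fun u => γ (t + s⁻¹ * u) with hc
  have hδ : 0 < s * min (τ - t) (t + τ) :=
    mul_pos hpos (lt_min (by linarith [ht.2]) (by linarith [ht.1]))
  have hgeo : F.IsGeodesicOn c (Ioo (-(s * min (τ - t) (t + τ))) (s * min (τ - t) (t + τ))) := by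
    refine (hγ.comp_affine t (inv_pos.2 hpos)).mono fun u hu => ?_
    have h1 : s⁻¹ * u < min (τ - t) (t + τ) := by
      rw [inv_mul_lt_iff₀ hpos]; exact hu.2
    have h2 : -min (τ - t) (t + τ) < s⁻¹ * u := by
      rw [lt_inv_mul_iff₀ hpos]; linarith [hu.1]
    exact ⟨by linarith [min_le_right (τ - t) (t + τ)], by linarith [min_le_left (τ - t) (t + τ)]⟩
  have hmd : MDifferentiableAt 𝓘(ℝ, ℝ) (𝓡 n) γ (t + s⁻¹ * 0) := by
    rw [mul_zero, add_zero]
    exact (hγ.1.contMDiffAt (isOpen_Ioo.mem_nhds ht)).mdifferentiableAt (by simp)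
  have hspeed : F.toFun (velocity c 0) = 1 := by
    rw [velocity_comp_affine t (inv_pos.2 hpos) hmd, mul_zero, add_zero, ← hs,
      inv_mul_cancel₀ hpos.ne']
  have h1 := le_lowerSecondDeriv_iff.1 (hlam c _ hδ hgeo (by simpa [hc] using hK) hspeed)
    (μ / s ^ 2) (by rw [div_lt_iff₀ (by positivity)]; exact hμ)
  have hcont : Tendsto (fun r : ℝ => s * r) (𝓝 0) (𝓝 0) := by
    have : Continuous fun r : ℝ => s * r := by fun_prop
    simpa using this.tendsto 0
  filter_upwards [hcont.eventually h1] with r hr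
  have e1 : c (s * r) = γ (t + r) := by simp [hc, inv_mul_cancel_left₀ hpos.ne']
  have e2 : c (-(s * r)) = γ (t - r) := by
    simp [hc, inv_mul_cancel_left₀ hpos.ne', sub_eq_add_neg]
  have e3 : c 0 = γ t := by simp [hc]
  rw [e1, e2, e3] at hr
  calc μ * r ^ 2 = μ / s ^ 2 * (s * r) ^ 2 := by field_simp
    _ ≤ _ := hr

end Geodesics

/-! ### Local smoothing in a chart -/

theorem _root_.IsCompact.exists_forall_of_nhds {X : Type*} [TopologicalSpace X] {S : Set X}
    (hS : IsCompact S) {P : ℝ → X → Prop} (hP : ∀ a b x, 0 < b → b ≤ a → P a x → P b x)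
    (h : ∀ x ∈ S, ∃ a > 0, ∃ W ∈ 𝓝 x, ∀ y ∈ W, P a y) : ∃ a > 0, ∀ x ∈ S, P a x := by
  refine hS.induction_on (p := fun s => ∃ a > 0, ∀ x ∈ s, P a x) ⟨1, one_pos, by simp⟩
    (fun s t hst ⟨a, ha, hat⟩ => ⟨a, ha, fun x hx => hat x (hst hx)⟩) ?_ ?_
  · rintro s t ⟨a, ha, has⟩ ⟨b, hb, hbt⟩
    refine ⟨min a b, lt_min ha hb, fun x hx => ?_⟩
    rcases hx with hx | hx
    · exact hP _ _ _ (lt_min ha hb) (min_le_left _ _) (has x hx)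
    · exact hP _ _ _ (lt_min ha hb) (min_le_right _ _) (hbt x hx)
  · intro x hx
    obtain ⟨a, ha, W, hW, hP'⟩ := h x hx
    exact ⟨W, mem_nhdsWithin_of_mem_nhds hW, a, ha, hP'⟩

section LocalSmoothing

variable {n : ℕ} {M : Type*} [TopologicalSpace M] [ChartedSpace (EuclideanSpace ℝ (Fin n)) M]
  [IsManifold (𝓡 n) ∞ M] (F : FinslerMetric n M)
  {φ : OpenPartialHomeomorph M (EuclideanSpace ℝ (Fin n))}

theorem inChart_zero (x : EuclideanSpace ℝ (Fin n)) : F.inChart φ x 0 = 0 := by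
  simpa using inChart_smul F (φ := φ) x 0 le_rfl

/-- On compact sets the Finsler norms are comparable with the Euclidean norm of the coordinates. -/
theorem exists_inChart_bounds (hφ : φ ∈ IsManifold.maximalAtlas (𝓡 n) ∞ M)
    {B : Set (EuclideanSpace ℝ (Fin n))} (hB : IsCompact B) (hBt : B ⊆ φ.target) :
    ∃ m > 0, ∃ C > 0, ∀ x ∈ B, ∀ y, m * ‖y‖ ≤ F.inChart φ x y ∧ F.inChart φ x y ≤ C * ‖y‖ := by
  have hne : ∀ y ∈ Metric.sphere (0 : EuclideanSpace ℝ (Fin n)) 1, y ≠ 0 := fun y hy h => by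
    simp [h] at hy
  have hc : ContinuousOn (fun p : EuclideanSpace ℝ (Fin n) × EuclideanSpace ℝ (Fin n) =>
      F.inChart φ p.1 p.2) (B ×ˢ Metric.sphere 0 1) :=
    (contDiffOn_inChart F hφ).continuousOn.mono fun p hp => ⟨hBt hp.1, hne _ hp.2⟩
  have hcomp := hB.prod (isCompact_sphere (0 : EuclideanSpace ℝ (Fin n)) 1)
  obtain ⟨m, hm, hmle⟩ := hcomp.exists_forall_le' hc (a := 0)
    fun p hp => inChart_pos F hφ (hBt hp.1) (hne _ hp.2)
  obtain ⟨C, hC⟩ := hcomp.bddAbove_image hc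
  refine ⟨m, hm, max C 1, by positivity, fun x hx y => ?_⟩
  rcases eq_or_ne y 0 with rfl | hy
  · simp [inChart_zero]
  have hy' : 0 < ‖y‖ := norm_pos_iff.2 hy
  have hmem : (x, ‖y‖⁻¹ • y) ∈ B ×ˢ Metric.sphere (0 : EuclideanSpace ℝ (Fin n)) 1 :=
    ⟨hx, by simp [norm_smul, hy'.ne']⟩
  have e : F.inChart φ x y = ‖y‖ * F.inChart φ x (‖y‖⁻¹ • y) := by
    rw [← inChart_smul F _ _ hy'.le, smul_inv_smul₀ hy'.ne']
  have h1 := hmle _ hmem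
  have h2 : F.inChart φ x (‖y‖⁻¹ • y) ≤ max C 1 :=
    (hC (mem_image_of_mem _ hmem)).trans (le_max_left _ _)
  rw [e, mul_comm m, mul_comm (max C 1)]
  exact ⟨by gcongr, by gcongr⟩

theorem isCompact_unit_vectors (hφ : φ ∈ IsManifold.maximalAtlas (𝓡 n) ∞ M)
    {B : Set (EuclideanSpace ℝ (Fin n))} (hB : IsCompact B) (hBt : B ⊆ φ.target) :
    IsCompact {p : EuclideanSpace ℝ (Fin n) × EuclideanSpace ℝ (Fin n) |
      p.1 ∈ B ∧ F.inChart φ p.1 p.2 = 1} := by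
  obtain ⟨m, hm, C, hC, hmC⟩ := exists_inChart_bounds F hφ hB hBt
  set T : Set (EuclideanSpace ℝ (Fin n) × EuclideanSpace ℝ (Fin n)) :=
    B ×ˢ (Metric.closedBall 0 m⁻¹ ∩ {y | C⁻¹ ≤ ‖y‖}) with hT
  have hTc : IsCompact T := hB.prod
    ((isCompact_closedBall _ _).inter_right (isClosed_le continuous_const continuous_norm))
  have hcont : ContinuousOn (fun p : EuclideanSpace ℝ (Fin n) × EuclideanSpace ℝ (Fin n) =>
      F.inChart φ p.1 p.2) T :=
    (contDiffOn_inChart F hφ).continuousOn.mono fun p hp => ⟨hBt hp.1, fun h => by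
      have h1 : C⁻¹ ≤ ‖p.2‖ := hp.2.2
      rw [show p.2 = 0 from h, norm_zero] at h1
      exact absurd h1 (not_le.2 (inv_pos.2 hC))⟩
  have hclosed :=
    hcont.preimage_isClosed_of_isClosed hTc.isClosed (isClosed_singleton (x := (1 : ℝ)))
  convert hTc.of_isClosed_subset hclosed inter_subset_left using 1
  ext p
  refine ⟨fun hp => ⟨⟨hp.1, ?_, ?_⟩, hp.2⟩, fun hp => ⟨hp.1.1, hp.2⟩⟩
  · rw [mem_closedBall_zero_iff, ← one_div, le_div_iff₀ hm, mul_comm, ← hp.2]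
    exact (hmC p.1 hp.1 p.2).1
  · rw [mem_ofPred_eq, inv_le_iff_one_le_mul₀' hC, ← hp.2]
    exact (hmC p.1 hp.1 p.2).2

/-- Solutions of the geodesic equation in the chart, of speed more than `1 / 2`, see the strong
convexity of `f`. -/
theorem le_secondDiff_of_isSolutionIn (hφ : φ ∈ IsManifold.maximalAtlas (𝓡 n) ∞ M) {f : M → ℝ}
    {h : EuclideanSpace ℝ (Fin n) → ℝ} (hh : Continuous h) {U : Set (EuclideanSpace ℝ (Fin n))}
    (hU : U ⊆ φ.target) (hhf : ∀ x ∈ U, h x = f (φ.symm x)) {lam : ℝ} (hlam0 : 0 < lam)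
    (hlam : ∀ (c : ℝ → M) (δ : ℝ), 0 < δ → F.IsGeodesicOn c (Ioo (-δ) δ) → c 0 ∈ φ.symm '' U →
      F.toFun (velocity c 0) = 1 → (lam : EReal) ≤ lowerSecondDeriv f c)
    {τ : ℝ} {α : ℝ → EuclideanSpace ℝ (Fin n) × EuclideanSpace ℝ (Fin n)}
    (hα : IsSolutionIn (F.accel φ) {p | p.1 ∈ U ∧ 1 / 2 < F.inChart φ p.1 p.2} τ α)
    {r : ℝ} (hr : r ∈ Ioo (-τ) τ) :
    lam / 4 * r ^ 2 ≤ h (α r).1 + h (α (-r)).1 - 2 * h (α 0).1 := by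
  have hgeo : F.IsGeodesicOn (fun t => φ.symm (α t).1) (Ioo (-τ) τ) :=
    (hα.mono (W' := φ.target ×ˢ {0}ᶜ) (fun p hp => ⟨hU hp.1, fun h0 => by
      have h1 := hp.2
      rw [show p.2 = 0 from h0, inChart_zero] at h1
      norm_num at h1⟩) le_rfl).isGeodesicOn hφ
  have hcont : ∀ t ∈ Ioo (-τ) τ, ContinuousAt (fun s => (α s).1) t := fun t ht =>
    (hα.hasDerivAt_fst ht).continuousAt
  refine le_secondDiff_of_eventually (k := fun t => h (α t).1) (fun t ht =>
    (hh.continuousAt.comp (hcont t ht)).continuousWithinAt) (fun t ht μ' hμ' => ?_) r hr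
  have hsrc : φ.symm (α t).1 ∈ φ.source := φ.map_target (hU (hα t ht).1.1)
  have hspeed : 1 / 2 < F.toFun (velocity (fun t => φ.symm (α t).1) t) := by
    rw [← inChart_deriv F hφ (γ := fun t => φ.symm (α t).1)
      ((hgeo.1.contMDiffAt (isOpen_Ioo.mem_nhds ht)).mdifferentiableAt (by simp)) hsrc,
      φ.right_inv (hU (hα t ht).1.1)]
    have e : (φ ∘ fun t => φ.symm (α t).1) =ᶠ[𝓝 t] fun s => (α s).1 := by
      filter_upwards [isOpen_Ioo.mem_nhds ht] with s hs using φ.right_inv (hU (hα s hs).1.1)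
    rw [e.deriv_eq, (hα.hasDerivAt_fst ht).deriv]
    exact (hα t ht).1.2
  have hev := eventually_le_secondDiff_of_isGeodesicOn hlam hgeo ht
    (mem_image_of_mem _ (hα t ht).1.1) (by linarith) (μ := μ') (by
      have h1 : (1 / 2) ^ 2 < F.toFun (velocity (fun t => φ.symm (α t).1) t) ^ 2 := by gcongr
      nlinarith [mul_lt_mul_of_pos_left h1 hlam0])
  have hmem : ∀ᶠ s in 𝓝 (0 : ℝ), t + s ∈ Ioo (-τ) τ ∧ t - s ∈ Ioo (-τ) τ := by
    have h1 : ContinuousAt (fun s : ℝ => t + s) 0 := by fun_prop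
    have h2 : ContinuousAt (fun s : ℝ => t - s) 0 := by fun_prop
    exact (h1.eventually_mem (by simpa using isOpen_Ioo.mem_nhds ht)).and
      (h2.eventually_mem (by simpa using isOpen_Ioo.mem_nhds ht))
  filter_upwards [hev, hmem] with s hs hs'
  rw [hhf _ (hα _ hs'.1).1.1, hhf _ (hα _ hs'.2).1.1, hhf _ (hα t ht).1.1]
  exact hs

/-- A mollification `v` of `f` in a chart, perturbed by a small multiple of a given smooth function
`b`, is uniformly geodesically convex on a compact ball. The error of the mollification is small
compared with the size of the perturbation. -/
theorem exists_local_smoothing (hφ : φ ∈ IsManifold.maximalAtlas (𝓡 n) ∞ M) {f : M → ℝ}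
    (hf : F.GeodesicallyConvex f) {x₀ : EuclideanSpace ℝ (Fin n)} {R R' : ℝ} (hR : R' < R)
    (hball : Metric.closedBall x₀ R ⊆ φ.target) {h : EuclideanSpace ℝ (Fin n) → ℝ} {L : ℝ≥0}
    (hh : LipschitzWith L h) (hhf : ∀ x ∈ Metric.closedBall x₀ R, h x = f (φ.symm x))
    {b : EuclideanSpace ℝ (Fin n) → ℝ} (hb : ContDiff ℝ ∞ b) {ε : ℝ} (hε : 0 < ε) :
    ∃ δ > 0, δ ≤ ε ∧ ∃ v : EuclideanSpace ℝ (Fin n) → ℝ, ContDiff ℝ ∞ v ∧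
      (∀ x, |v x - h x| ≤ δ / 8) ∧ ∃ lam : ℝ, 0 < lam ∧ ∀ (c : ℝ → M) (δ' : ℝ), 0 < δ' →
        F.IsGeodesicOn c (Ioo (-δ') δ') → c 0 ∈ φ.source → φ (c 0) ∈ Metric.closedBall x₀ R' →
        F.toFun (velocity c 0) = 1 →
          (lam : EReal) ≤ lowerSecondDeriv (fun p => v (φ p) + δ * b (φ p)) c := by
  obtain ⟨lam, hlam0, hlam⟩ := hf (φ.symm '' Metric.closedBall x₀ R)
    ((isCompact_closedBall _ _).image_of_continuousOn (φ.continuousOn_symm.mono hball))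
  set S := {p : EuclideanSpace ℝ (Fin n) × EuclideanSpace ℝ (Fin n) |
    p.1 ∈ Metric.closedBall x₀ R' ∧ F.inChart φ p.1 p.2 = 1} with hSdef
  have hsub : Metric.closedBall x₀ R' ⊆ φ.target :=
    (Metric.closedBall_subset_closedBall hR.le).trans hball
  have hS : IsCompact S := isCompact_unit_vectors F hφ (isCompact_closedBall _ _) hsub
  have hSne : ∀ p ∈ S, p.2 ≠ 0 := fun p hp h0 => by
    have h1 := hp.2
    rw [h0, inChart_zero] at h1
    norm_num at h1
  have hΓ : ∀ p ∈ S, ContDiffAt ℝ 1 (F.accel φ) p := fun p hp =>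
    contDiffAt_accel F hφ (hsub hp.1) (hSne p hp)
  obtain ⟨a, ha, hA⟩ := hS.exists_forall_of_nhds
    (P := fun a p => ∀ τ > 0, ∀ β : ℝ → EuclideanSpace ℝ (Fin n) × EuclideanSpace ℝ (Fin n),
      IsSolutionIn (F.accel φ) univ τ β → β 0 = p →
      ∀ᶠ r in 𝓝 (0 : ℝ), |b (β r).1 + b (β (-r)).1 - 2 * b (β 0).1| ≤ a⁻¹ * r ^ 2)
    (fun a a' p ha' haa hP τ hτ β hβ hβ0 => by
      filter_upwards [hP τ hτ β hβ hβ0] with r hr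
      refine hr.trans ?_
      gcongr)
    (fun p hp => by
      obtain ⟨A, hA, W, hW, H⟩ := exists_abs_secondDiff_le (hΓ p hp).continuousAt hb
      refine ⟨A⁻¹, inv_pos.2 hA, W, hW, fun q hq τ hτ β hβ hβ0 => ?_⟩
      rw [inv_inv]
      exact H τ hτ β hβ (hβ0 ▸ hq))
  -- With this choice the perturbation costs at most half of the convexity constant `lam / 8`.
  set δ := min ε (lam / 16 * a) with hδ
  have hδ0 : 0 < δ := lt_min hε (by positivity)
  obtain ⟨σ, hσ, hmol⟩ := hS.exists_forall_of_nhds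
    (P := fun σ p => ∀ ρ : ContDiffBump (0 : EuclideanSpace ℝ (Fin n)), ρ.rOut ≤ σ →
      ∀ τ > 0, ∀ β : ℝ → EuclideanSpace ℝ (Fin n) × EuclideanSpace ℝ (Fin n),
      IsSolutionIn (F.accel φ) univ τ β → β 0 = p → ∀ᶠ r in 𝓝 (0 : ℝ),
        lam / 8 * r ^ 2 ≤
          mollify ρ h (β r).1 + mollify ρ h (β (-r)).1 - 2 * mollify ρ h (β 0).1)
    (fun a a' p _ haa hP ρ hρ => hP ρ (hρ.trans haa))
    (fun p hp => by
      have hpx : p.1 ∈ φ.target := hsub hp.1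
      have hW : {q : EuclideanSpace ℝ (Fin n) × EuclideanSpace ℝ (Fin n) |
          q.1 ∈ Metric.closedBall x₀ R ∧ 1 / 2 < F.inChart φ q.1 q.2} ∈ 𝓝 p := by
        have h1 : ∀ᶠ q in 𝓝 p, q.1 ∈ Metric.closedBall x₀ R :=
          continuousAt_fst.eventually (Metric.closedBall_mem_nhds_of_mem
            (Metric.closedBall_subset_ball hR hp.1))
        have h2 : ∀ᶠ q in 𝓝 p, 1 / 2 < F.inChart φ q.1 q.2 :=
          (contDiffAt_inChart F hφ hpx (hSne p hp)).continuousAt.eventually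
            (lt_mem_nhds (by
              change 1 / 2 < F.inChart φ p.1 p.2
              rw [hp.2]; norm_num))
        exact h1.and h2
      obtain ⟨σ, hσ, W', hW', H⟩ := exists_mollify_secondDiff (hΓ p hp) hh
        (show lam / 8 < lam / 4 by linarith) hW (fun τ α hα r hr =>
          le_secondDiff_of_isSolutionIn F hφ hh.continuous hball hhf hlam0 hlam hα hr)
      exact ⟨σ, hσ, W', hW', fun q hq ρ hρ τ hτ β hβ hβ0 => H ρ hρ τ hτ β hβ (hβ0 ▸ hq)⟩)
  set s := min σ (δ / (8 * (L + 1))) with hs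
  have hs0 : 0 < s := lt_min hσ (by positivity)
  let ρ : ContDiffBump (0 : EuclideanSpace ℝ (Fin n)) := ⟨s / 2, s, by positivity, by linarith⟩
  refine ⟨δ, hδ0, min_le_left _ _, mollify ρ h, contDiff_mollify ρ hh.continuous, fun x => ?_,
    lam / 16, by positivity, fun c δ' hδ' hc hsrc hcb hspeed => ?_⟩
  · calc |mollify ρ h x - h x| ≤ L * ρ.rOut := abs_mollify_sub_le ρ hh x
      _ ≤ (L + 1) * (δ / (8 * (L + 1))) := by
        gcongr
        · linarith
        · exact min_le_right _ _
      _ = δ / 8 := by field_simp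
  · obtain ⟨τ, hτ, hβ⟩ := hc.exists_isSolutionIn hδ' hφ hsrc
    have hβS : (φ (c 0), deriv (φ ∘ c) 0) ∈ S := by
      refine ⟨hcb, ?_⟩
      rw [← hspeed]
      exact inChart_deriv F hφ ((hc.1.contMDiffAt
        (Ioo_mem_nhds (by linarith) hδ')).mdifferentiableAt (by simp)) hsrc
    refine le_lowerSecondDeriv_iff.2 fun μ hμ => ?_
    filter_upwards [hA _ hβS τ hτ _ hβ rfl, hmol _ hβS ρ (min_le_left _ _) τ hτ _ hβ rfl]
      with r h1 h2
    have h3 : δ * |b (φ (c r)) + b (φ (c (-r))) - 2 * b (φ (c 0))| ≤ lam / 16 * r ^ 2 := by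
      calc _ ≤ (lam / 16 * a) * (a⁻¹ * r ^ 2) := by
            gcongr
            exact min_le_right _ _
        _ = lam / 16 * r ^ 2 := by field_simp
    have h4 : δ * -|b (φ (c r)) + b (φ (c (-r))) - 2 * b (φ (c 0))| ≤
        δ * (b (φ (c r)) + b (φ (c (-r))) - 2 * b (φ (c 0))) := by
      gcongr
      exact neg_abs_le _
    have h5 : μ * r ^ 2 ≤ lam / 16 * r ^ 2 := by gcongr
    simp only at h2
    linarith

end LocalSmoothing

/-! ### Lipschitz functions in charts -/

section Lipschitz

variable {n : ℕ} {M : Type*} [TopologicalSpace M] [ChartedSpace (EuclideanSpace ℝ (Fin n)) M]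

/-- `f` is locally Lipschitz when read in the preferred charts of the manifold. Unlike Lipschitz
continuity for the Finsler distance on all compact sets, this condition is visibly local. -/
def LocallyLipschitzInCharts (n : ℕ) {M : Type*} [TopologicalSpace M]
    [ChartedSpace (EuclideanSpace ℝ (Fin n)) M] (f : M → ℝ) : Prop :=
  ∀ c : M, LocallyLipschitzOn (chartAt (EuclideanSpace ℝ (Fin n)) c).target
    (f ∘ (chartAt (EuclideanSpace ℝ (Fin n)) c).symm)

variable [IsManifold (𝓡 n) ∞ M] (F : FinslerMetric n M)
  {φ : OpenPartialHomeomorph M (EuclideanSpace ℝ (Fin n))}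

/-- The Finsler distance is bounded by the length of the coordinate segment. -/
theorem dist_symm_le (hφ : φ ∈ IsManifold.maximalAtlas (𝓡 n) ∞ M)
    {B : Set (EuclideanSpace ℝ (Fin n))} (hB : Convex ℝ B) (hBt : B ⊆ φ.target) {C : ℝ}
    (hC : ∀ x ∈ B, ∀ y, F.inChart φ x y ≤ C * ‖y‖) {x y : EuclideanSpace ℝ (Fin n)} (hx : x ∈ B)
    (hy : y ∈ B) : F.dist (φ.symm x) (φ.symm y) ≤ ENNReal.ofReal (C * ‖y - x‖) := by
  set ℓ : ℝ → EuclideanSpace ℝ (Fin n) := fun t => x + t • (y - x) with hℓ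
  have hmem : ∀ t ∈ Icc (0 : ℝ) 1, ℓ t ∈ B := fun t ht => by
    have := hB.add_smul_sub_mem hx hy ht
    exact this
  have hℓs : ContDiff ℝ ∞ ℓ := by fun_prop
  have hγ : ∀ t ∈ Icc (0 : ℝ) 1, ContMDiffAt 𝓘(ℝ, ℝ) (𝓡 n) ∞ (φ.symm ∘ ℓ) t := fun t ht =>
    ((contMDiffOn_symm_of_mem_maximalAtlas hφ).contMDiffAt
      (φ.open_target.mem_nhds (hBt (hmem t ht)))).comp t hℓs.contMDiff.contMDiffAt
  have hspeed : ∀ t ∈ Icc (0 : ℝ) 1, F.toFun (velocity (φ.symm ∘ ℓ) t) ≤ C * ‖y - x‖ := by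
    intro t ht
    have htt := hBt (hmem t ht)
    rw [← inChart_deriv F hφ ((hγ t ht).mdifferentiableAt (by simp)) (φ.map_target htt)]
    have e : (φ ∘ φ.symm ∘ ℓ) =ᶠ[𝓝 t] ℓ := by
      filter_upwards [hℓs.continuous.continuousAt.preimage_mem_nhds (φ.open_target.mem_nhds htt)]
        with s hs using φ.right_inv hs
    have hd : HasDerivAt ℓ (y - x) t := by
      have := ((hasDerivAt_id t).smul_const (y - x)).const_add x
      rw [one_smul] at this
      exact this
    rw [e.deriv_eq, hd.deriv, Function.comp_apply, φ.right_inv htt]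
    exact hC _ (hmem t ht) _
  have hpw : PiecewiseSmoothOn n (φ.symm ∘ ℓ) 0 1 := by
    refine ⟨1, ![0, 1], ?_, rfl, rfl, fun i => ?_⟩
    · intro i j hij
      fin_cases i <;> fin_cases j <;> simp at hij ⊢
    · fin_cases i
      exact fun t ht => (hγ t ht).contMDiffWithinAt
  have hlen : F.length (φ.symm ∘ ℓ) 0 1 ≤ ENNReal.ofReal (C * ‖y - x‖) := by
    unfold FinslerMetric.length
    calc ∫⁻ t in Icc (0 : ℝ) 1, ENNReal.ofReal (F.toFun (velocity (φ.symm ∘ ℓ) t))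
        ≤ ∫⁻ _ in Icc (0 : ℝ) 1, ENNReal.ofReal (C * ‖y - x‖) :=
          setLIntegral_mono measurable_const fun t ht => ENNReal.ofReal_le_ofReal (hspeed t ht)
      _ = ENNReal.ofReal (C * ‖y - x‖) := by simp
  refine le_trans ?_ hlen
  unfold FinslerMetric.dist
  refine (iInf_le _ (φ.symm ∘ ℓ)).trans <| (iInf_le _ 0).trans <| (iInf_le _ 1).trans <|
    (iInf_le _ zero_le_one).trans <| (iInf_le _ hpw).trans <| (iInf_le _ ?_).trans (iInf_le _ ?_)
  · simp [hℓ]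
  · simp [hℓ]

theorem FinslerMetric.LocallyLipschitz.inCharts {F : FinslerMetric n M} {f : M → ℝ}
    (hf : F.LocallyLipschitz f) : LocallyLipschitzInCharts n f := by
  intro c x hx
  have hφ := IsManifold.chart_mem_maximalAtlas (I := 𝓡 n) (n := ∞) c
  set φ := chartAt (EuclideanSpace ℝ (Fin n)) c
  obtain ⟨r, hr, hball⟩ := Metric.nhds_basis_closedBall.mem_iff.1 (φ.open_target.mem_nhds hx)
  have hcomp := isCompact_closedBall x r
  obtain ⟨L, hL⟩ := hf _ (hcomp.image_of_continuousOn (φ.continuousOn_symm.mono hball))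
  obtain ⟨_, -, C, hC, hCle⟩ := exists_inChart_bounds F hφ hcomp hball
  refine ⟨L * C.toNNReal, Metric.closedBall x r,
    mem_nhdsWithin_of_mem_nhds (Metric.closedBall_mem_nhds x hr), ?_⟩
  refine LipschitzOnWith.of_dist_le_mul fun y hy z hz => ?_
  have h1 := (hL _ (mem_image_of_mem _ hy) _ (mem_image_of_mem _ hz)).trans
    (mul_le_mul_right (dist_symm_le F hφ (convex_closedBall x r) hball
      (fun x hx y => (hCle x hx y).2) hy hz) _)
  rw [← ENNReal.ofReal_coe_nnreal, ← ENNReal.ofReal_mul L.coe_nonneg,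
    ENNReal.ofReal_le_ofReal_iff (by positivity)] at h1
  rw [Real.dist_eq, dist_eq_norm, norm_sub_rev y z, NNReal.coe_mul, mul_assoc,
    Real.coe_toNNReal C hC.le]
  exact h1

end Lipschitz

/-! ### Local geodesic convexity -/

section ConvexAt

variable {n : ℕ} {M : Type*} [TopologicalSpace M] [ChartedSpace (EuclideanSpace ℝ (Fin n)) M]
  [IsManifold (𝓡 n) ∞ M] {F : FinslerMetric n M} {f g : M → ℝ} {p : M}

/-- Geodesic convexity with a uniform constant near the point `p`. -/
def FinslerMetric.ConvexAt (F : FinslerMetric n M) (f : M → ℝ) (p : M) : Prop :=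
  ∃ U ∈ 𝓝 p, ∃ lam : ℝ, 0 < lam ∧ ∀ (c : ℝ → M) (δ : ℝ), 0 < δ →
    F.IsGeodesicOn c (Ioo (-δ) δ) → c 0 ∈ U → F.toFun (velocity c 0) = 1 →
      (lam : EReal) ≤ lowerSecondDeriv f c

theorem geodesicallyConvex_iff_convexAt : F.GeodesicallyConvex f ↔ ∀ p, F.ConvexAt f p := by
  constructor
  · intro h p
    have : LocallyCompactSpace M := ChartedSpace.locallyCompactSpace (EuclideanSpace ℝ (Fin n)) M
    obtain ⟨K, hK, hKp⟩ := exists_compact_mem_nhds p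
    obtain ⟨lam, hlam, H⟩ := h K hK
    exact ⟨K, hKp, lam, hlam, H⟩
  · intro h K hK
    obtain ⟨a, ha, H⟩ := hK.exists_forall_of_nhds
      (P := fun lam p => ∀ (c : ℝ → M) (δ : ℝ), 0 < δ → F.IsGeodesicOn c (Ioo (-δ) δ) → c 0 = p →
        F.toFun (velocity c 0) = 1 → (lam : EReal) ≤ lowerSecondDeriv f c)
      (fun a b p _ hba hP c δ hδ hc hp hs =>
        (EReal.coe_le_coe_iff.2 hba).trans (hP c δ hδ hc hp hs))
      (fun p _ => by
        obtain ⟨U, hU, lam, hlam, H⟩ := h p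
        exact ⟨lam, hlam, U, hU, fun q hq c δ hδ hc hcq => H c δ hδ hc (hcq ▸ hq)⟩)
    exact ⟨a, ha, fun c δ hδ hc hcK => H _ hcK c δ hδ hc rfl⟩

theorem FinslerMetric.IsGeodesicOn.continuousAt_zero {c : ℝ → M} {δ : ℝ} (hδ : 0 < δ)
    (hc : F.IsGeodesicOn c (Ioo (-δ) δ)) : ContinuousAt c 0 :=
  (hc.1.contMDiffAt (Ioo_mem_nhds (by linarith) hδ)).continuousAt

theorem lowerSecondDeriv_congr {c : ℝ → M} (hc : ContinuousAt c 0) (h : f =ᶠ[𝓝 (c 0)] g) :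
    lowerSecondDeriv f c = lowerSecondDeriv g c := by
  have hneg : Tendsto (fun r : ℝ => c (-r)) (𝓝 0) (𝓝 (c 0)) := by
    have h1 : Tendsto (fun r : ℝ => -r) (𝓝 0) (𝓝 0) := by simpa using tendsto_neg (0 : ℝ)
    exact hc.tendsto.comp h1
  refine liminf_congr (Eventually.filter_mono nhdsWithin_le_nhds ?_)
  filter_upwards [hc.eventually h, hneg.eventually h] with r h1 h2
  rw [h1, h2, h.self_of_nhds]

theorem FinslerMetric.ConvexAt.congr (hf : F.ConvexAt f p) (h : f =ᶠ[𝓝 p] g) :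
    F.ConvexAt g p := by
  obtain ⟨U, hU, lam, hlam, H⟩ := hf
  refine ⟨U ∩ {q | f =ᶠ[𝓝 q] g}, inter_mem hU h.eventuallyEq_nhds, lam, hlam,
    fun c δ hδ hc hc0 hs => ?_⟩
  rw [← lowerSecondDeriv_congr (hc.continuousAt_zero hδ) hc0.2]
  exact H c δ hδ hc hc0.1 hs

theorem FinslerMetric.ConvexAt.softMax (hf : F.ConvexAt f p) (hg : F.ConvexAt g p) {η : ℝ}
    (hη : 0 < η) : F.ConvexAt (fun q => softMax η (f q) (g q)) p := by
  obtain ⟨U, hU, lam, hlam, H⟩ := hf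
  obtain ⟨U', hU', lam', hlam', H'⟩ := hg
  refine ⟨U ∩ U', inter_mem hU hU', min lam lam', lt_min hlam hlam', fun c δ hδ hc hc0 hs => ?_⟩
  refine le_lowerSecondDeriv_iff.2 fun μ hμ => ?_
  filter_upwards [
    le_lowerSecondDeriv_iff.1 (H c δ hδ hc hc0.1 hs) μ (hμ.trans_le (min_le_left _ _)),
    le_lowerSecondDeriv_iff.1 (H' c δ hδ hc hc0.2 hs) μ (hμ.trans_le (min_le_right _ _))]
    with r h1 h2 using softMax_secondDiff hη h1 h2

end ConvexAt

/-! ### One smoothing step -/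

section Step

variable {n : ℕ} {M : Type*} [TopologicalSpace M] [ChartedSpace (EuclideanSpace ℝ (Fin n)) M]

theorem contDiff_softMax (η : ℝ) : ContDiff ℝ ∞ fun q : ℝ × ℝ => softMax η q.1 q.2 := by
  unfold softMax
  exact contDiff_snd.add (contDiff_const.mul
    (contDiff_softPos.comp ((contDiff_fst.sub contDiff_snd).div_const η)))

theorem abs_softMax_sub_softMax_le {η : ℝ} (hη : 0 < η) (a b a' b' : ℝ) :
    |softMax η a b - softMax η a' b'| ≤ |a - a'| + 2 * |b - b'| := by
  have h1 := lipschitzWith_softPos.dist_le_mul ((a - b) / η) ((a' - b') / η)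
  rw [Real.dist_eq, Real.dist_eq, NNReal.coe_one, one_mul, ← sub_div, abs_div, abs_of_pos hη,
    le_div_iff₀ hη] at h1
  have e : softMax η a b - softMax η a' b' =
      (b - b') + (softPos ((a - b) / η) - softPos ((a' - b') / η)) * η := by
    unfold softMax; ring
  have h2 : |a - b - (a' - b')| ≤ |a - a'| + |b - b'| := by
    rw [show a - b - (a' - b') = (a - a') - (b - b') by ring]
    exact abs_sub _ _
  rw [e]
  refine (abs_add_le _ _).trans ?_
  rw [abs_mul, abs_of_pos hη]
  linarith

/-- The local Lipschitz property is preserved by a modification that is locally the smooth maximum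
with a smooth function. -/
theorem LocallyLipschitzInCharts.of_eventuallyEq [IsManifold (𝓡 n) ∞ M] {f f' : M → ℝ}
    (hf : LocallyLipschitzInCharts n f)
    (h : ∀ p, f' =ᶠ[𝓝 p] f ∨ ∃ (u : M → ℝ) (η : ℝ), 0 < η ∧
      ContMDiffAt (𝓡 n) 𝓘(ℝ, ℝ) ∞ u p ∧ f' =ᶠ[𝓝 p] fun q => softMax η (u q) (f q)) :
    LocallyLipschitzInCharts n f' := by
  intro c x hx
  have hψ := IsManifold.chart_mem_maximalAtlas (I := 𝓡 n) (n := ∞) c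
  obtain ⟨K, t, ht, hK⟩ := hf c hx
  set ψ := chartAt (EuclideanSpace ℝ (Fin n)) c
  have hcont : Tendsto ψ.symm (𝓝[ψ.target] x) (𝓝 (ψ.symm x)) :=
    (ψ.continuousAt_symm hx).tendsto.mono_left nhdsWithin_le_nhds
  rcases h (ψ.symm x) with h | ⟨u, η, hη, hu, h⟩
  · refine ⟨K, t ∩ {z | f' (ψ.symm z) = f (ψ.symm z)}, inter_mem ht (hcont.eventually h), ?_⟩
    refine LipschitzOnWith.of_dist_le_mul fun y hy z hz => ?_
    rw [Function.comp_apply, Function.comp_apply, hy.2, hz.2]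
    exact hK.dist_le_mul y hy.1 z hz.1
  · have hus : ContDiffAt ℝ 1 (u ∘ ψ.symm) x :=
      ((hu.comp x ((contMDiffOn_symm_of_mem_maximalAtlas hψ).contMDiffAt
        (ψ.open_target.mem_nhds hx))).contDiffAt).of_le ENat.LEInfty.out
    obtain ⟨K', t', ht', hK'⟩ := hus.exists_lipschitzOnWith
    refine ⟨K' + 2 * K, t ∩ t' ∩ {z | f' (ψ.symm z) = softMax η (u (ψ.symm z)) (f (ψ.symm z))},
      inter_mem (inter_mem ht (mem_nhdsWithin_of_mem_nhds ht')) (hcont.eventually h), ?_⟩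
    refine LipschitzOnWith.of_dist_le_mul fun y hy z hz => ?_
    rw [Function.comp_apply, Function.comp_apply, hy.2, hz.2, Real.dist_eq]
    refine (abs_softMax_sub_softMax_le hη _ _ _ _).trans ?_
    have h1 := hK.dist_le_mul y hy.1.1 z hz.1.1
    have h2 := hK'.dist_le_mul y hy.1.2 z hz.1.2
    rw [Real.dist_eq] at h1 h2
    push_cast
    simp only [Function.comp_apply] at h1 h2
    linarith

variable [T2Space M] [IsManifold (𝓡 n) ∞ M] {F : FinslerMetric n M}

/-- A locally Lipschitz, geodesically convex function can be modified on the support of a bump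
function `b` so as to become smooth where `b = 1`, without losing smoothness elsewhere: it is
replaced by its smooth maximum with a local mollification, which is lifted where `b = 1` and lowered
where `b = 0`. -/
theorem exists_smoothing_step {c₀ : M} (b : SmoothBumpFunction (𝓡 n) c₀) {f : M → ℝ}
    (hL : LocallyLipschitzInCharts n f) (hf : F.GeodesicallyConvex f) {ε : ℝ} (hε : 0 < ε) :
    ∃ f' : M → ℝ, LocallyLipschitzInCharts n f' ∧ F.GeodesicallyConvex f' ∧
      (∀ x, |f' x - f x| ≤ ε) ∧ (∀ x ∉ tsupport b, f' x = f x) ∧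
      (∀ x, b =ᶠ[𝓝 x] 1 → ContMDiffAt (𝓡 n) 𝓘(ℝ, ℝ) ∞ f' x) ∧
      ∀ x, ContMDiffAt (𝓡 n) 𝓘(ℝ, ℝ) ∞ f x → ContMDiffAt (𝓡 n) 𝓘(ℝ, ℝ) ∞ f' x := by
  classical
  have hφ := IsManifold.chart_mem_maximalAtlas (I := 𝓡 n) (n := ∞) c₀
  have hLc := hL c₀
  set φ := chartAt (EuclideanSpace ℝ (Fin n)) c₀ with hφdef
  set x₀ := φ c₀ with hx₀
  have hbapp : ∀ q ∈ φ.source, b q = b.toContDiffBump (φ q) := fun q hq => by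
    rw [b.eqOn_source hq]; rfl
  have hBt : Metric.closedBall x₀ b.rOut ⊆ φ.target := by
    have := b.closedBall_subset
    simpa using this
  -- A slightly larger closed ball still lies in the chart domain.
  obtain ⟨d, hd, hthick⟩ :=
    (isCompact_closedBall x₀ b.rOut).exists_cthickening_subset_open φ.open_target hBt
  rw [cthickening_closedBall hd.le b.rOut_pos.le] at hthick
  obtain ⟨L, hLip⟩ := (hLc.mono hthick).exists_lipschitzOnWith_of_compact
    (isCompact_closedBall x₀ (d + b.rOut))
  obtain ⟨h, hh, hhf⟩ := hLip.extend_real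
  obtain ⟨δ, hδ, hδε, v, hv, hvh, lam, hlam, hconv⟩ := exists_local_smoothing F hφ hf
    (R' := d / 2 + b.rOut) (by linarith) hthick hh (fun x hx => (hhf hx).symm)
    (b := fun x => b.toContDiffBump x - 1 / 2) (b.toContDiffBump.contDiff.sub contDiff_const) hε
  set u : M → ℝ := fun q => v (φ q) + δ * (b.toContDiffBump (φ q) - 1 / 2) with hu
  set U : Set M := φ.source ∩ φ ⁻¹' Metric.ball x₀ (d / 2 + b.rOut) with hU
  have hUo : IsOpen U := φ.isOpen_inter_preimage Metric.isOpen_ball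
  have hsub : tsupport b ⊆ U := by
    refine b.tsupport_subset_symm_image_closedBall.trans ?_
    rintro _ ⟨x, hx, rfl⟩
    have hx' : x ∈ Metric.closedBall x₀ b.rOut := hx.1
    refine ⟨φ.map_target (hBt hx'), ?_⟩
    change φ (φ.symm x) ∈ Metric.ball x₀ (d / 2 + b.rOut)
    rw [φ.right_inv (hBt hx')]
    exact Metric.closedBall_subset_ball (by linarith) hx'
  have hvf : ∀ q ∈ U, |v (φ q) - f q| ≤ δ / 8 := fun q hq => by
    have h1 := hvh (φ q)
    rwa [← hhf (Metric.ball_subset_closedBall.trans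
      (Metric.closedBall_subset_closedBall (by linarith)) hq.2), Function.comp_apply,
      φ.left_inv hq.1] at h1
  have hus : ∀ q ∈ U, ContMDiffAt (𝓡 n) 𝓘(ℝ, ℝ) ∞ u q := fun q hq => by
    have h1 : ContDiff ℝ ∞ fun x => v x + δ * (b.toContDiffBump x - 1 / 2) :=
      hv.add (contDiff_const.mul (b.toContDiffBump.contDiff.sub contDiff_const))
    exact h1.contMDiff.contMDiffAt.comp q
      ((contMDiffOn_of_mem_maximalAtlas hφ).contMDiffAt (φ.open_source.mem_nhds hq.1))
  set f' : M → ℝ := fun q => if q ∈ U then softMax (δ / 4) (u q) (f q) else f q with hf'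
  have hη : 0 < δ / 4 := by positivity
  have hin : ∀ q ∈ U, f' =ᶠ[𝓝 q] fun q => softMax (δ / 4) (u q) (f q) := fun q hq => by
    filter_upwards [hUo.mem_nhds hq] with z hz using if_pos hz
  have hout : ∀ q ∉ tsupport b, f' q = f q := fun q hq => by
    by_cases hqU : q ∈ U
    · simp only [hf', if_pos hqU]
      refine softMax_of_le hη ?_
      have h1 : b.toContDiffBump (φ q) = 0 := by
        rw [← hbapp q hqU.1]; exact image_eq_zero_of_notMem_tsupport hq
      have h2 := (abs_le.1 (hvf q hqU)).2
      simp only [hu, h1]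
      linarith
    · exact if_neg hqU
  have hout' : ∀ q ∉ tsupport b, f' =ᶠ[𝓝 q] f := fun q hq => by
    filter_upwards [(isClosed_tsupport b).isOpen_compl.mem_nhds hq] with z hz using hout z hz
  have hcases : ∀ q, q ∈ U ∨ q ∉ tsupport b := fun q =>
    (em (q ∈ tsupport b)).imp (fun h => hsub h) id
  refine ⟨f', hL.of_eventuallyEq fun q => ?_, geodesicallyConvex_iff_convexAt.2 fun q => ?_,
    fun q => ?_, hout, fun q hq => ?_, fun q hq => ?_⟩
  · rcases hcases q with hq | hq
    · exact Or.inr ⟨u, δ / 4, hη, hus q hq, hin q hq⟩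
    · exact Or.inl (hout' q hq)
  · have hfq := geodesicallyConvex_iff_convexAt.1 hf q
    rcases hcases q with hq | hq
    · have huq : F.ConvexAt u q := ⟨U, hUo.mem_nhds hq, lam, hlam, fun c δ' hδ' hc hc0 hs =>
        hconv c δ' hδ' hc hc0.1 (Metric.ball_subset_closedBall hc0.2) hs⟩
      exact (huq.softMax hfq hη).congr (hin q hq).symm
    · exact hfq.congr (hout' q hq).symm
  · by_cases hqU : q ∈ U
    · simp only [hf', if_pos hqU]
      refine abs_softMax_sub_le hη hε.le ?_
      have h1 := (abs_le.1 (hvf q hqU)).2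
      have h2 : δ * (b.toContDiffBump (φ q) - 1 / 2) ≤ δ * (1 / 2) := by
        gcongr
        linarith [b.toContDiffBump.le_one (x := φ q)]
      simp only [hu]
      linarith
    · simp only [hf', if_neg hqU, sub_self, abs_zero]
      exact hε.le
  · have hqU : q ∈ U := hsub (subset_tsupport b (by
      rw [Function.mem_support, hq.self_of_nhds]; simp))
    have e : f' =ᶠ[𝓝 q] fun z => u z + δ / 4 * (softPos 1 - 1) := by
      filter_upwards [hin q hqU, hUo.mem_nhds hqU, hq] with z h1 h2 h3
      rw [h1]
      refine softMax_of_add_le hη ?_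
      have h4 := (abs_le.1 (hvf z h2)).1
      have h5 : b.toContDiffBump (φ z) = 1 := by rw [← hbapp z h2.1, h3]; rfl
      simp only [hu, h5]
      linarith
    exact ((hus q hqU).add contMDiffAt_const).congr_of_eventuallyEq e
  · rcases hcases q with hqU | hqU
    · exact ((contDiff_softMax (δ / 4)).contMDiff.contMDiffAt.comp q
        ((hus q hqU).prodMk_space hq)).congr_of_eventuallyEq (hin q hqU)
    · exact hq.congr_of_eventuallyEq (hout' q hqU)

end Step

/-! ### Successive smoothing -/

section Limit

variable {n : ℕ} {M : Type*} [TopologicalSpace M] [ChartedSpace (EuclideanSpace ℝ (Fin n)) M]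
  [IsManifold (𝓡 n) ∞ M] {F : FinslerMetric n M}

/-- Smoothing steps over a countable family of bump functions, with geometrically decreasing
errors. -/
theorem exists_smoothing_sequence [T2Space M] {ι : Type*} {e : ι → ℕ} (he : Function.Injective e)
    {c : ι → M} (b : ∀ i, SmoothBumpFunction (𝓡 n) (c i)) {f : M → ℝ}
    (hL : LocallyLipschitzInCharts n f) (hf : F.GeodesicallyConvex f) {ε : ℝ} (hε : 0 < ε) :
    ∃ s : ℕ → M → ℝ, (∀ k, F.GeodesicallyConvex (s k)) ∧
      (∀ k x, |s k x - f x| ≤ ε * (1 - (1 / 2) ^ k)) ∧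
      (∀ k x, (∀ i, e i = k → x ∉ tsupport (b i)) → s (k + 1) x = s k x) ∧
      (∀ i x, b i =ᶠ[𝓝 x] 1 → ContMDiffAt (𝓡 n) 𝓘(ℝ, ℝ) ∞ (s (e i + 1)) x) ∧
      ∀ k x, ContMDiffAt (𝓡 n) 𝓘(ℝ, ℝ) ∞ (s k) x →
        ContMDiffAt (𝓡 n) 𝓘(ℝ, ℝ) ∞ (s (k + 1)) x := by
  let S := {f : M → ℝ // LocallyLipschitzInCharts n f ∧ F.GeodesicallyConvex f}
  have step : ∀ (k : ℕ) (f : S), ∃ f' : S, (∀ x, |f'.1 x - f.1 x| ≤ ε * (1 / 2) ^ (k + 1)) ∧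
      (∀ x, (∀ i, e i = k → x ∉ tsupport (b i)) → f'.1 x = f.1 x) ∧
      (∀ i, e i = k → ∀ x, b i =ᶠ[𝓝 x] 1 → ContMDiffAt (𝓡 n) 𝓘(ℝ, ℝ) ∞ f'.1 x) ∧
      ∀ x, ContMDiffAt (𝓡 n) 𝓘(ℝ, ℝ) ∞ f.1 x → ContMDiffAt (𝓡 n) 𝓘(ℝ, ℝ) ∞ f'.1 x := by
    intro k f
    have hk : 0 < ε * (1 / 2) ^ (k + 1) := by positivity
    by_cases hi : ∃ i, e i = k
    · obtain ⟨i, rfl⟩ := hi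
      obtain ⟨f', h1, h2, h3, h4, h5, h6⟩ := exists_smoothing_step (b i) f.2.1 f.2.2 hk
      exact ⟨⟨f', h1, h2⟩, h3, fun x hx => h4 x (hx i rfl),
        fun j hj x hx => h5 x (he hj ▸ hx), h6⟩
    · push Not at hi
      exact ⟨f, fun x => by simpa using hk.le, fun _ _ => rfl, fun i hik => absurd hik (hi i),
        fun _ h => h⟩
  choose next h1 h2 h3 h4 using step
  let s : ℕ → S := fun k => Nat.rec ⟨f, hL, hf⟩ next k
  refine ⟨fun k => (s k).1, fun k => (s k).2.2, fun k x => ?_, fun k => h2 k (s k),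
    fun i => h3 (e i) (s (e i)) i rfl, fun k => h4 k (s k)⟩
  induction k with
  | zero => simp [s]
  | succ k ih =>
    have h5 := h1 k (s k) x
    calc |(s (k + 1)).1 x - f x|
        ≤ |(s (k + 1)).1 x - (s k).1 x| + |(s k).1 x - f x| := abs_sub_le _ _ _
      _ ≤ ε * (1 / 2) ^ (k + 1) + ε * (1 - (1 / 2) ^ k) := add_le_add h5 ih
      _ = ε * (1 - (1 / 2) ^ (k + 1)) := by ring

end Limit

end Finsler

theorem mainTheorem3 {n : ℕ} {M : Type*} [TopologicalSpace M] [T2Space M]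
    [SecondCountableTopology M] [ChartedSpace (EuclideanSpace ℝ (Fin n)) M]
    [IsManifold (𝓡 n) ∞ M] (F : Finsler.FinslerMetric n M) (f : M → ℝ)
    (hf : F.LocallyLipschitz f) (hconv : F.GeodesicallyConvex f) (ε : ℝ) (hε : 0 < ε) :
    ∃ g : M → ℝ, ContMDiff (𝓡 n) 𝓘(ℝ, ℝ) ∞ g ∧ F.GeodesicallyConvex g ∧
      ∀ x : M, |g x - f x| < ε := by
  have : LocallyCompactSpace M := ChartedSpace.locallyCompactSpace (EuclideanSpace ℝ (Fin n)) M
  obtain ⟨ι, b, -⟩ := SmoothBumpCovering.exists_isSubordinate (𝓡 n) (M := M) isClosed_univ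
    (U := fun _ => univ) fun _ _ => univ_mem
  have hcount : Countable ι := Set.countable_univ_iff.1
    (b.locallyFinite.countable_univ fun i => (b.toFun i).nonempty_support)
  obtain ⟨e, he⟩ := exists_injective_nat ι
  obtain ⟨s, hsconv, hsf, hsupp, hsmooth, hkeep⟩ :=
    Finsler.exists_smoothing_sequence he (fun i => b i) hf.inCharts hconv hε
  -- The sequence is locally eventually constant, since the supports are locally finite.
  have hstat : ∀ x : M, ∃ (N : ℕ) (U : Set M), U ∈ 𝓝 x ∧ ∀ y ∈ U, ∀ k ≥ N, s k y = s N y := by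
    intro x
    obtain ⟨U, hU, hfin⟩ := b.locallyFinite.closure x
    obtain ⟨N, hN⟩ := (hfin.image e).bddAbove
    refine ⟨N + 1, U, hU, fun y hy k hk => ?_⟩
    induction k, hk using Nat.le_induction with
    | base => rfl
    | succ k hk ih =>
      rw [← ih]
      refine hsupp k y fun i hik hyi => ?_
      have := hN (mem_image_of_mem e (show i ∈ _ from ⟨y, hyi, hy⟩))
      omega
  choose N U hU hNU using hstat
  have hloc : ∀ x, ∀ k ≥ N x, (fun y => s (N y) y) =ᶠ[𝓝 x] s k := by
    intro x k hk
    filter_upwards [hU x] with y hy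
    rw [← hNU y y (mem_of_mem_nhds (hU y)) _ (le_max_left (N y) (N x)),
      hNU x y hy _ (le_max_right (N y) (N x)), hNU x y hy k hk]
  refine ⟨fun y => s (N y) y, fun x => ?_, ?_, fun x => ?_⟩
  · obtain ⟨i, hi⟩ := b.eventuallyEq_one' x (mem_univ x)
    have hsm : ∀ k ≥ e i + 1, ContMDiffAt (𝓡 n) 𝓘(ℝ, ℝ) ∞ (s k) x := by
      intro k hk
      induction k, hk using Nat.le_induction with
      | base => exact hsmooth i x hi
      | succ k _ ih => exact hkeep k x ih
    exact (hsm _ (le_max_right (N x) _)).congr_of_eventuallyEq (hloc x _ (le_max_left _ _))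
  · exact Finsler.geodesicallyConvex_iff_convexAt.2 fun x =>
      (Finsler.geodesicallyConvex_iff_convexAt.1 (hsconv (N x)) x).congr (hloc x _ le_rfl).symm
  · refine (hsf (N x) x).trans_lt ?_
    have : 0 < ε * (1 / 2) ^ N x := by positivity
    linarith
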